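/- Let $\mathbb H$ be the quaternions, $\mathbb B=\{q\in\mathbb H:|q|<1\}$, and let $\mathbb S^2$ be the sphere of purely imaginary unit quaternions. For $i\in\mathbb S^2$ let $\mathbb C(i)=\{x+yi: x,y\in\mathbb R\}$ and $\mathbb B_i=\mathbb B\cap\mathbb C(i)$. A function $f:\mathbb B\to\mathbb H$ is slice regular if it is real differentiable and $\left(\frac{\partial}{\partial x}+i\frac{\partial}{\partial y}\right)f(x+yi)=0$ on $\mathbb B_i$ for every $i\in\mathbb S^2$. Let $dA_i$ be the area measure on $\mathbb B_i$ normalized to total mass $1$, and put $$d\lambda_i(z)=\frac{dA_i(z)}{(1-|z|^2)^2},\qquad dA_{\alpha,i}(z)=(\alpha+1)(1-|z|^2)^{\alpha}\,dA_i(z)\quad(\alpha>-1).$$ For $1\le p<\infty$ and $n\in\mathbb N$ with $np>1$, the Besov space $\mathcal B_p$ (defined with derivatives of order $n$) is the set of slice regular functions $f$ on $\mathbb B$ with $$\sup_{i\in\mathbb S^2}\int_{\mathbb B_i}\left|(1-|z|^2)^n\,\partial_{x_0}^n f(z)\right|^p d\lambda_i(z)<\infty,$$ where $\partial_{x_0}$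 is the derivative in the real direction. Let $L^p(\mathbb B_i,d\lambda_i,\mathbb H)$ be the set of measurable $h:\mathbb B_i\to\mathbb H$ with $\int_{\mathbb B_i}|h|^p\,d\lambda_i<\infty$. For $w\in\mathbb B_i$ let $K_\alpha(\cdot,w)$ be the slice regular extension to $\mathbb B$ of the function $k_w(z)=(1-z\bar w)^{-(2+\alpha)}$ (principal branch) on $\mathbb B_i$, that is, for $q=x+yI_q$ with $x,y\in\mathbb R$ and $I_q\in\mathbb S^2$, $$K_\alpha(q,w)=\tfrac12\left[(1+I_q i)\,k_w(x-yi)+(1-I_q i)\,k_w(x+yi)\right],$$ and put $$\mathbf K_{\alpha,i}[h](q)=\int_{\mathbb B_i}K_\alpha(q,w)\,h(w)\,dA_{\alpha,i}(w),\qquad q\in\mathbb B.$$ **Proposition.** Let $\alpha>-1$, $1\le p<\infty$, let $n\in\mathbb N$ with $np>1$, and let $f$ be slice regular on $\mathbb B$. Then, for every $i\in\mathbb S^2$, $f\in\mathcal B_p$ if and only if there is $h\in L^p(\mathbb B_i,d\lambda_i,\mathbb H)$ with $f(q)=\mathbf K_{\alpha,i}[h](q)$ for all $q\in\mathbb B$.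 -/

import Mathlib

open scoped Quaternion

namespace SliceBesov

/-- The quaternions carry their Borel σ-algebra. -/
noncomputable instance instMeasurableSpaceQuaternion : MeasurableSpace ℍ[ℝ] := borel ℍ[ℝ]

instance instBorelSpaceQuaternion : BorelSpace ℍ[ℝ] := ⟨rfl⟩

/-- The sphere `𝕊²` of purely imaginary unit quaternions. -/
def unitSphere : Set ℍ[ℝ] := {i | i.re = 0 ∧ ‖i‖ = 1}

/-- The open unit ball `𝔹` of the quaternions. -/
def unitBall : Set ℍ[ℝ] := Metric.ball 0 1

/-- For `i ∈ 𝕊²`, the identification `x + y√-1 ↦ x + y i` of `ℂ` with the plane `ℂ(i)`. -/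
noncomputable def slice (i : ℍ[ℝ]) (z : ℂ) : ℍ[ℝ] := (z.re : ℍ[ℝ]) + (z.im : ℍ[ℝ]) * i

theorem continuous_slice (i : ℍ[ℝ]) : Continuous (slice i) := by
  unfold slice
  exact (Quaternion.continuous_coe.comp Complex.continuous_re).add
    ((Quaternion.continuous_coe.comp Complex.continuous_im).mul continuous_const)

/-- The standard basis unit `e₁` of the quaternions. -/
def e₁ : ℍ[ℝ] := ⟨0, 1, 0, 0⟩

open Classical in
/-- The imaginary unit `I_q = q⃗ / |q⃗|` of a nonreal quaternion `q`. A real quaternion lies in every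
plane `ℂ(i)`; for it the unit `e₁` is taken. -/
noncomputable def imUnit (q : ℍ[ℝ]) : ℍ[ℝ] :=
  if q.im = 0 then e₁ else ((‖q.im‖⁻¹ : ℝ) : ℍ[ℝ]) * q.im

/-- The complex number `x + y√-1` with `q = x + I_q y`, `y = |q⃗| ≥ 0`. -/
noncomputable def coord (q : ℍ[ℝ]) : ℂ := ⟨q.re, ‖q.im‖⟩

/-- A function is (left) slice regular on an open set `Ω` if it is real differentiable there and,
for every `i ∈ 𝕊²`, satisfies `(∂/∂x + i ∂/∂y) f(x + y i) = 0` on `Ω ∩ ℂ(i)`. -/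
def IsSliceRegularOn (f : ℍ[ℝ] → ℍ[ℝ]) (Ω : Set ℍ[ℝ]) : Prop :=
  DifferentiableOn ℝ f Ω ∧
    ∀ i ∈ unitSphere, ∀ x y : ℝ, (x : ℍ[ℝ]) + (y : ℍ[ℝ]) * i ∈ Ω →
      deriv (fun s : ℝ => f ((s : ℍ[ℝ]) + (y : ℍ[ℝ]) * i)) x
        + i * deriv (fun t : ℝ => f ((x : ℍ[ℝ]) + (t : ℍ[ℝ]) * i)) y = 0

/-- The iterated derivative `∂ⁿf/∂x₀ⁿ` in the real direction. -/
noncomputable def realDeriv (n : ℕ) (f : ℍ[ℝ] → ℍ[ℝ]) (q : ℍ[ℝ]) : ℍ[ℝ] :=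
  iteratedDeriv n (fun t : ℝ => f (q + (t : ℍ[ℝ]))) 0

/-- The extension operator `P_i`: a function on the disc `𝔹_i`, given as `F : ℂ → ℍ` in the
coordinate `z = x + y√-1` of the point `x + y i`, is extended to
`q = x + y I_q ↦ ½ [(1 + I_q i) F(x - y i) + (1 - I_q i) F(x + y i)]`. -/
noncomputable def sliceExt (i : ℍ[ℝ]) (F : ℂ → ℍ[ℝ]) (q : ℍ[ℝ]) : ℍ[ℝ] :=
  (2⁻¹ : ℝ) • ((1 + imUnit q * i) * F (starRingEnd ℂ (coord q))
    + (1 - imUnit q * i) * F (coord q))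

/-- The weighted slice regular Bergman kernel `K_α(q, w)`: for fixed `w`, the slice regular
extension `P_{I_w}` of the function `z ↦ (1 - z w̄)^{-(2+α)}` (principal branch) on the disc of the
plane `ℂ(I_w)` that contains `w`. -/
noncomputable def kernel (α : ℝ) (q w : ℍ[ℝ]) : ℍ[ℝ] :=
  sliceExt (imUnit w)
    (fun z => slice (imUnit w)
      ((1 - z * starRingEnd ℂ (coord w)) ^ (-((2 + α : ℝ) : ℂ)))) q

/-- The normalized area measure `dA_i` of the disc `𝔹_i = 𝔹 ∩ ℂ(i)` (total mass `1`), as a measure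
on `ℍ` that is carried by `𝔹_i`. -/
noncomputable def areaMeasure (i : ℍ[ℝ]) : MeasureTheory.Measure ℍ[ℝ] :=
  ENNReal.ofReal (Real.pi⁻¹) •
    (MeasureTheory.volume.restrict (Metric.ball (0 : ℂ) 1)).map (slice i)

/-- The measure `dλ_i(z) = dA_i(z) / (1 - |z|²)²`. -/
noncomputable def lambdaMeasure (i : ℍ[ℝ]) : MeasureTheory.Measure ℍ[ℝ] :=
  (areaMeasure i).withDensity (fun z => ENNReal.ofReal (((1 - ‖z‖ ^ 2) ^ 2)⁻¹))

/-- The measure `dA_{α,i}(z) = (α + 1) (1 - |z|²)^α dA_i(z)`. -/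
noncomputable def weightedMeasure (α : ℝ) (i : ℍ[ℝ]) : MeasureTheory.Measure ℍ[ℝ] :=
  (areaMeasure i).withDensity (fun z => ENNReal.ofReal ((α + 1) * (1 - ‖z‖ ^ 2) ^ α))

/-- The slice regular Besov space `B_p`, defined with derivatives of an order `n` such that
`n p > 1`: the slice regular functions on `𝔹` with
`sup_{i ∈ 𝕊²} ∫_{𝔹_i} |(1 - |z|²)ⁿ ∂ⁿf/∂x₀ⁿ(z)|^p dλ_i(z) < ∞`. -/
def besovSpace (p : ℝ) (n : ℕ) : Set (ℍ[ℝ] → ℍ[ℝ]) :=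
  {f | IsSliceRegularOn f unitBall ∧
    (⨆ i ∈ unitSphere,
      (∫⁻ z, ‖(1 - ‖z‖ ^ 2) ^ n • realDeriv n f z‖ₑ ^ p ∂(lambdaMeasure i) : ENNReal)) < ⊤}

/-- The Bergman type projection `K_{α,i}[h](q) = ∫_{𝔹_i} K_α(q, w) h(w) dA_{α,i}(w)`. Only the
values of `h` on `𝔹_i` matter. -/
noncomputable def bergmanProj (α : ℝ) (i : ℍ[ℝ]) (h : ℍ[ℝ] → ℍ[ℝ]) (q : ℍ[ℝ]) : ℍ[ℝ] :=
  ∫ w, kernel α q w * h w ∂(weightedMeasure α i)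

end SliceBesov

/-! Everything can be read off a single disc. Give ℍ the complex structure of left multiplication by
i. Then slice regularity makes the restriction of f to 𝔹_i a holomorphic function with values in a
complex Banach space (`differentiableOn_restr`), whose complex derivatives are the derivatives of f
in the real direction (`toSlice_realDeriv`). The Taylor coefficients at 0 are the same on all
slices, whence the representation formula: on any slice, f and its real derivatives are
combinations, with bounded coefficients, of their values at z and z̄ on 𝔹_i. So the supremum over
all slices is finite as soon as the integral over 𝔹_i is (`mem_besovSpace_iff`), and 𝐊_{α,i} is the
extension of the complex Bergman operator P_α (`bergmanProj_eq_sliceExt`). It remains to show, for F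
holomorphic on the disc, that (1-|z|²)ⁿF⁽ⁿ⁾ ∈ L^p(dλ) if and only if F = P_α h with h ∈ L^p(dλ).

If F = P_α h, differentiation under the integral bounds (1-|z|²)ⁿ|F⁽ⁿ⁾(z)| by a constant times the
integral of |h| dλ against (1-|z|²)ⁿ(1-|w|²)^{α+2}/|1-zw̄|^{n+α+2}. This operator is bounded on
L^p(dλ) by Schur's test with powers of 1-|z|², which the Forelli–Rudin estimate controls exactly
when np > 1 (`exists_lintegral_discKernel_rpow_le`). The form of Schur's test used, by Jensen's
inequality, includes p = 1.

Conversely, h is explicit (`exists_eqOn_discProj`). The n-th derivative of P_α h carries a factor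
w̄ⁿ in the integrand, so h should be a multiple of (1-|w|²)ⁿ w̄⁻ⁿ F⁽ⁿ⁾(w). To keep this bounded at
0, the Taylor polynomial of F⁽ⁿ⁾ of degree below n is removed first, and a term (1-|w|²)ⁿP(w) with P
a polynomial of degree below 2n restores what is missing. That P_α h = F is checked on Taylor
coefficients at 0: those of P_α h are moments of h, which circle averages and Beta integrals
evaluate. -/

open scoped Quaternion

namespace SliceBesov

open MeasureTheory Set
open scoped ENNReal Real ComplexConjugate

/-! ### Forelli–Rudin estimates on the disc. -/

/-- `∫₀^∞ x^t (x + δ)^{-(1 + t + c)} dx = O(δ^{-c})`. -/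
theorem lintegral_rpow_mul_add_rpow_le {t c : ℝ} (ht : -1 < t) (hc : 0 < c) :
    ∃ C : ℝ, 0 ≤ C ∧ ∀ δ : ℝ, 0 < δ →
      ∫⁻ x in Ioi (0 : ℝ), ENNReal.ofReal (x ^ t * (x + δ) ^ (-(1 + t + c)))
        ≤ ENNReal.ofReal (C * δ ^ (-c)) := by
  -- The integral is split at x = δ: below it x + δ is replaced by δ, above it by x. The constants
  -- are ∫₀¹ x^t dx and ∫₁^∞ x^{-1-c} dx.
  refine ⟨1 / (t + 1) + 1 / c, by have : 0 < t + 1 := by linarith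
                                  positivity, fun δ hδ => ?_⟩
  have hs : -(1 + t + c) ≤ 0 := by linarith
  have h1 : ∫⁻ x in Ioc (0 : ℝ) δ, ENNReal.ofReal (x ^ t * (x + δ) ^ (-(1 + t + c)))
      ≤ ENNReal.ofReal (1 / (t + 1) * δ ^ (-c)) := by
    have hint : IntegrableOn (fun x : ℝ => x ^ t * δ ^ (-(1 + t + c))) (Ioc 0 δ) := by
      have := (intervalIntegral.intervalIntegrable_rpow' (a := 0) (b := δ) ht)
      rw [intervalIntegrable_iff_integrableOn_Ioc_of_le hδ.le] at this
      exact this.mul_const _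
    calc _ ≤ ∫⁻ x in Ioc (0 : ℝ) δ, ENNReal.ofReal (x ^ t * δ ^ (-(1 + t + c))) := by
          refine setLIntegral_mono' measurableSet_Ioc fun x hx => ENNReal.ofReal_le_ofReal ?_
          have := hx.1
          exact mul_le_mul_of_nonneg_left
            (Real.rpow_le_rpow_of_nonpos hδ (by linarith) hs) (by positivity)
      _ = ENNReal.ofReal (1 / (t + 1) * δ ^ (-c)) := by
          rw [← ofReal_integral_eq_lintegral_ofReal hint]
          · rw [integral_mul_const, ← intervalIntegral.integral_of_le hδ.le,
              integral_rpow (Or.inl ht), Real.zero_rpow (by linarith), sub_zero, div_mul_eq_mul_div,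
              ← Real.rpow_add hδ]
            congr 1
            rw [show t + 1 + -(1 + t + c) = -c by ring]
            ring
          · filter_upwards [ae_restrict_mem measurableSet_Ioc] with x hx
            have := hx.1
            simp only [Pi.zero_apply]
            positivity
  have h2 : ∫⁻ x in Ioi δ, ENNReal.ofReal (x ^ t * (x + δ) ^ (-(1 + t + c)))
      ≤ ENNReal.ofReal (1 / c * δ ^ (-c)) := by
    have hlt : -1 - c < -1 := by linarith
    calc _ ≤ ∫⁻ x in Ioi δ, ENNReal.ofReal (x ^ (-1 - c)) := by
          refine setLIntegral_mono' measurableSet_Ioi fun x hx => ENNReal.ofReal_le_ofReal ?_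
          have hx0 : 0 < x := hδ.trans hx
          calc x ^ t * (x + δ) ^ (-(1 + t + c)) ≤ x ^ t * x ^ (-(1 + t + c)) :=
                mul_le_mul_of_nonneg_left
                  (Real.rpow_le_rpow_of_nonpos hx0 (by linarith) hs) (by positivity)
            _ = _ := by rw [← Real.rpow_add hx0]; congr 1; ring
      _ = ENNReal.ofReal (1 / c * δ ^ (-c)) := by
          rw [← ofReal_integral_eq_lintegral_ofReal (integrableOn_Ioi_rpow_of_lt hlt hδ)]
          · rw [integral_Ioi_rpow_of_lt hlt hδ]
            congr 1
            rw [show -1 - c + 1 = -c by ring]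
            field_simp
          · filter_upwards [ae_restrict_mem measurableSet_Ioi] with x hx
            have : 0 < x := hδ.trans hx
            simp only [Pi.zero_apply]
            positivity
  rw [← Ioc_union_Ioi_eq_Ioi hδ.le, add_mul, ENNReal.ofReal_add]
  · exact (lintegral_union_le _ _ _).trans (add_le_add h1 h2)
  · have : 0 < t + 1 := by linarith
    positivity
  · positivity

/-- The identity |1-xe^{iθ}|² = (1-x)² + 4x sin²(θ/2) controls 1-x at once. It controls |θ| through
Jordan's inequality when x ≥ 1/2; when x ≤ 1/2 the norm is at least 1/2 and |θ| ≤ π suffices. -/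
theorem add_abs_le_norm_one_sub_polar {x θ : ℝ} (hx0 : 0 ≤ x) (hx1 : x ≤ 1) (hθ : |θ| ≤ π) :
    (1 - x) + |θ| ≤ 4 * π * ‖1 - (x : ℂ) * (Real.cos θ + Real.sin θ * Complex.I)‖ := by
  set N := ‖1 - (x : ℂ) * (Real.cos θ + Real.sin θ * Complex.I)‖ with hN
  have hsq : N ^ 2 = (1 - x) ^ 2 + 4 * x * Real.sin (θ / 2) ^ 2 := by
    rw [hN, Complex.sq_norm, Complex.normSq_apply]
    have h1 := Real.sin_sq_add_cos_sq θ
    have h2 : Real.cos θ = 1 - 2 * Real.sin (θ / 2) ^ 2 := by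
      have := Real.cos_two_mul (θ / 2)
      have h3 := Real.sin_sq_add_cos_sq (θ / 2)
      rw [show 2 * (θ / 2) = θ by ring] at this
      linarith
    simp only [Complex.sub_re, Complex.one_re, Complex.mul_re, Complex.ofReal_re, Complex.add_re,
      Complex.I_re, Complex.ofReal_im, Complex.I_im, Complex.add_im, Complex.mul_im, Complex.sub_im,
      Complex.one_im]
    linear_combination x ^ 2 * h1 - 2 * x * h2
  have hN0 : 0 ≤ N := norm_nonneg _
  have hpi : 3 < π := Real.pi_gt_three
  have hA : 1 - x ≤ N := by
    apply le_of_sq_le_sq _ hN0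
    rw [hsq]
    nlinarith [mul_nonneg hx0 (sq_nonneg (Real.sin (θ / 2)))]
  have hB : |θ| ≤ 2 * π * N := by
    rcases le_total x (1 / 2) with h | h
    · nlinarith
    · have hs : 2 / π * |θ / 2| ≤ |Real.sin (θ / 2)| := by
        apply Real.mul_abs_le_abs_sin
        rw [abs_div, abs_two]
        linarith
      rw [abs_div, abs_two] at hs
      have hs' : |θ| / π ≤ |Real.sin (θ / 2)| := by
        calc |θ| / π = 2 / π * (|θ| / 2) := by ring
          _ ≤ _ := hs
      have h5 : |Real.sin (θ / 2)| ≤ N := by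
        apply le_of_sq_le_sq _ hN0
        rw [hsq, sq_abs]
        nlinarith [sq_nonneg (1 - x), sq_nonneg (Real.sin (θ / 2))]
      have := hs'.trans h5
      rw [div_le_iff₀ (by positivity)] at this
      nlinarith
  nlinarith

/-- The normalized area measure of the complex unit disc. -/
noncomputable def discArea : Measure ℂ :=
  ENNReal.ofReal (π⁻¹) • volume.restrict (Metric.ball (0 : ℂ) 1)

instance : IsFiniteMeasure discArea := by
  constructor
  rw [discArea, Measure.smul_apply, Measure.restrict_apply_univ, smul_eq_mul]
  exact ENNReal.mul_lt_top ENNReal.ofReal_lt_top measure_ball_lt_top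

theorem ae_discArea_mem_ball : ∀ᵐ w ∂discArea, ‖w‖ < 1 := by
  have : ∀ᵐ w ∂volume.restrict (Metric.ball (0 : ℂ) 1), ‖w‖ < 1 := by
    filter_upwards [ae_restrict_mem Metric.isOpen_ball.measurableSet] with w hw
    simpa using hw
  exact Measure.ae_smul_measure this _

theorem lintegral_discArea (g : ℂ → ℝ≥0∞) (hg : Measurable g) :
    ∫⁻ w, g w ∂discArea = ENNReal.ofReal (π⁻¹) * ∫⁻ r in Ioo (0 : ℝ) 1, ∫⁻ θ in Ioo (-π) π,
      ENNReal.ofReal r * g (r * (Real.cos θ + Real.sin θ * Complex.I)) := by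
  rw [discArea, lintegral_smul_measure, smul_eq_mul]
  congr 1
  rw [← lintegral_indicator Metric.isOpen_ball.measurableSet, ← Complex.lintegral_comp_polarCoord_symm]
  simp only [Complex.polarCoord_symm_apply]
  rw [polarCoord_target, Measure.volume_eq_prod, setLIntegral_prod]
  · rw [← Ioo_union_Ici_eq_Ioi zero_lt_one, lintegral_union measurableSet_Ici
      (Set.disjoint_left.2 fun x hx hx' => not_lt.2 hx' hx.2)]
    have h0 : ∫⁻ r in Ici (1 : ℝ), ∫⁻ θ in Ioo (-π) π, ENNReal.ofReal r •
        (Metric.ball (0 : ℂ) 1).indicator g (r * (Real.cos θ + Real.sin θ * Complex.I)) = 0 := by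
      rw [setLIntegral_congr_fun (g := fun _ => 0) measurableSet_Ici, lintegral_zero]
      intro r hr
      have hr : 1 ≤ r := hr
      have : ∀ θ : ℝ, (Metric.ball (0 : ℂ) 1).indicator g
          (r * (Real.cos θ + Real.sin θ * Complex.I)) = 0 := by
        intro θ
        apply indicator_of_notMem
        have := Complex.norm_cos_add_sin_mul_I θ
        simp only [← Complex.ofReal_cos, ← Complex.ofReal_sin] at this
        simp [this, abs_of_nonneg (zero_le_one.trans hr), hr, -Complex.ofReal_cos,
          -Complex.ofReal_sin]
      simp [this, -Complex.ofReal_cos, -Complex.ofReal_sin]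
    rw [h0, add_zero]
    refine setLIntegral_congr_fun measurableSet_Ioo fun r hr => lintegral_congr fun θ => ?_
    rw [smul_eq_mul, indicator_of_mem]
    have := Complex.norm_cos_add_sin_mul_I θ
    simp only [← Complex.ofReal_cos, ← Complex.ofReal_sin] at this
    simp [this, abs_of_pos hr.1, hr.2, -Complex.ofReal_cos, -Complex.ofReal_sin]
  · apply Measurable.aemeasurable
    refine Measurable.fun_smul (by fun_prop) ?_
    apply (hg.indicator Metric.isOpen_ball.measurableSet).comp
    fun_prop

theorem setLIntegral_comp_abs_le (g : ℝ → ℝ≥0∞) (s : Set ℝ) :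
    ∫⁻ x in s, g |x| ≤ 2 * ∫⁻ x in Ioi (0 : ℝ), g x := by
  have h1 : ∫⁻ x in Ioi (0 : ℝ), g |x| = ∫⁻ x in Ioi (0 : ℝ), g x :=
    setLIntegral_congr_fun measurableSet_Ioi fun x hx => by
      simp only [abs_of_pos (show 0 < x from hx)]
  have h2 : ∫⁻ x in Iio (0 : ℝ), g |x| = ∫⁻ x in Ioi (0 : ℝ), g x := by
    rw [← h1, ← (Measure.measurePreserving_neg (volume : Measure ℝ)).setLIntegral_comp_preimage_emb
      (Homeomorph.neg ℝ).measurableEmbedding]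
    simp
  calc ∫⁻ x in s, g |x| ≤ ∫⁻ x, g |x| := setLIntegral_le_lintegral _ _
    _ = ∫⁻ x in Iio (0 : ℝ) ∪ Ioi 0, g |x| := by
        rw [← setLIntegral_univ, Iio_union_Ioi]
        exact setLIntegral_congr (ae_eq_univ.2 (by simp)).symm
    _ ≤ _ := lintegral_union_le _ _ _
    _ = _ := by rw [h1, h2, two_mul]

theorem measurePreserving_mul_discArea {u : ℂ} (hu : ‖u‖ = 1) :
    MeasurePreserving (fun w => u * w) discArea discArea := by
  have h1 : MeasurePreserving (rotation ⟨u, by simpa [Submonoid.unitSphere] using hu⟩)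
      (volume : Measure ℂ) volume := LinearIsometryEquiv.measurePreserving _
  have h2 := h1.restrict_preimage (s := Metric.ball (0 : ℂ) 1) Metric.isOpen_ball.measurableSet
  have h3 : (rotation ⟨u, by simpa [Submonoid.unitSphere] using hu⟩ : ℂ → ℂ) ⁻¹' Metric.ball 0 1
      = Metric.ball 0 1 := by
    ext w
    simp
  rw [h3] at h2
  exact h2.smul_measure _

theorem measurable_kernelNorm (z : ℂ) (t s : ℝ) : Measurable fun w : ℂ =>
    ENNReal.ofReal ((1 - ‖w‖ ^ 2) ^ t * ‖1 - z * conj w‖ ^ s) := by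
  fun_prop

/-- The factor 1+r lies in [1,2], and the exponent |t| covers both signs of t. -/
theorem one_sub_sq_rpow_le (t : ℝ) {r : ℝ} (h0 : 0 ≤ r) (h1 : r < 1) :
    (1 - r ^ 2) ^ t ≤ 2 ^ |t| * (1 - r) ^ t := by
  rw [show 1 - r ^ 2 = (1 + r) * (1 - r) by ring, Real.mul_rpow (by linarith) (by linarith)]
  refine mul_le_mul_of_nonneg_right ?_ (Real.rpow_nonneg (by linarith) _)
  calc (1 + r) ^ t ≤ (1 + r) ^ |t| := Real.rpow_le_rpow_of_exponent_le (by linarith) (le_abs_self t)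
    _ ≤ 2 ^ |t| := Real.rpow_le_rpow (by linarith) (by linarith) (abs_nonneg t)

/-- The Forelli–Rudin estimate for a point of the positive radius. -/
theorem exists_lintegral_kernel_le_of_real {t c : ℝ} (ht : -1 < t) (hc : 0 < c) :
    ∃ C : ℝ, 0 ≤ C ∧ ∀ ρ : ℝ, 0 ≤ ρ → ρ < 1 →
      ∫⁻ w, ENNReal.ofReal ((1 - ‖w‖ ^ 2) ^ t * ‖1 - (ρ : ℂ) * conj w‖ ^ (-(2 + t + c)))
        ∂discArea ≤ ENNReal.ofReal (C * (1 - ρ) ^ (-c)) := by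
  set s := 2 + t + c with hs
  have hs1 : 0 < s - 1 := by linarith
  -- The half-line estimate serves twice: with t = 0 for the angle, where δ = 1-ρr, and with the
  -- given t for the radius, where x = 1-r and δ = 1-ρ. The power s-1 = 1+t+c left by the first is
  -- the one the second needs.
  obtain ⟨C₁, hC₁, H₁⟩ := lintegral_rpow_mul_add_rpow_le (t := 0) (c := s - 1) (by norm_num) hs1
  obtain ⟨C₂, hC₂, H₂⟩ := lintegral_rpow_mul_add_rpow_le ht hc
  set K : ℝ := 2 ^ |t| * (4 * π) ^ s with hK
  have hK0 : 0 ≤ K := by positivity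
  refine ⟨π⁻¹ * (K * 2 * C₁ * 2 ^ (s - 1) * C₂), by positivity, fun ρ hρ0 hρ1 => ?_⟩
  rw [lintegral_discArea _ (measurable_kernelNorm _ _ _)]
  rw [mul_assoc π⁻¹, ENNReal.ofReal_mul (by positivity : 0 ≤ π⁻¹)]
  refine mul_le_mul_right ?_ _
  have inner : ∀ r ∈ Ioo (0 : ℝ) 1, ∫⁻ θ in Ioo (-π) π, ENNReal.ofReal r * ENNReal.ofReal
      ((1 - ‖(r : ℂ) * (Real.cos θ + Real.sin θ * Complex.I)‖ ^ 2) ^ t *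
        ‖1 - (ρ : ℂ) * conj ((r : ℂ) * (Real.cos θ + Real.sin θ * Complex.I))‖ ^ (-s))
      ≤ ENNReal.ofReal (K * 2 * C₁ * 2 ^ (s - 1)) *
        ENNReal.ofReal ((1 - r) ^ t * ((1 - r) + (1 - ρ)) ^ (-(1 + t + c))) := by
    intro r hr
    have hδ : 0 < 1 - ρ * r := by nlinarith [hr.1, hr.2]
    have hr1 : 0 < 1 - r := by linarith [hr.2]
    calc _ ≤ ∫⁻ θ in Ioo (-π) π, ENNReal.ofReal (K * (1 - r) ^ t) *
            ENNReal.ofReal (|θ| ^ (0 : ℝ) * (|θ| + (1 - ρ * r)) ^ (-(1 + 0 + (s - 1)))) := by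
          refine setLIntegral_mono' measurableSet_Ioo fun θ hθ => ?_
          rw [← ENNReal.ofReal_mul hr.1.le, ← ENNReal.ofReal_mul (by positivity)]
          apply ENNReal.ofReal_le_ofReal
          have hn : ‖(r : ℂ) * (Real.cos θ + Real.sin θ * Complex.I)‖ = r := by
            rw [norm_mul, Complex.ofReal_cos, Complex.ofReal_sin, Complex.norm_cos_add_sin_mul_I,
              Complex.norm_real, Real.norm_of_nonneg hr.1.le, mul_one]
          have hc' : ‖1 - (ρ : ℂ) * conj ((r : ℂ) * (Real.cos θ + Real.sin θ * Complex.I))‖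
              = ‖1 - ((ρ * r : ℝ) : ℂ) * (Real.cos θ + Real.sin θ * Complex.I)‖ := by
            rw [← Complex.norm_conj]
            congr 1
            simp only [map_sub, map_one, map_mul, Complex.conj_ofReal, Complex.conj_conj]
            push_cast
            ring
          have key := add_abs_le_norm_one_sub_polar (x := ρ * r) (θ := θ)
            (mul_nonneg hρ0 hr.1.le) (by linarith) (abs_le.2 ⟨hθ.1.le, hθ.2.le⟩)
          rw [hn, hc']
          set N := ‖1 - ((ρ * r : ℝ) : ℂ) * (Real.cos θ + Real.sin θ * Complex.I)‖
          have hpos : 0 < |θ| + (1 - ρ * r) := by have := abs_nonneg θ; linarith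
          have hN : N ^ (-s) ≤ (4 * π) ^ s * (|θ| + (1 - ρ * r)) ^ (-s) := by
            have h4 : (|θ| + (1 - ρ * r)) / (4 * π) ≤ N := by
              rw [div_le_iff₀ (by positivity)]
              linarith
            calc N ^ (-s) ≤ ((|θ| + (1 - ρ * r)) / (4 * π)) ^ (-s) :=
                  Real.rpow_le_rpow_of_nonpos (by positivity) h4 (by linarith)
              _ = _ := by
                  rw [Real.div_rpow hpos.le (by positivity), Real.rpow_neg (by positivity : 0 ≤ 4 * π)]
                  field_simp
          have hsq := one_sub_sq_rpow_le t hr.1.le hr.2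
          rw [Real.rpow_zero, one_mul, show -(1 + 0 + (s - 1)) = -s by ring, hK]
          have h5 : 0 ≤ (1 - r ^ 2) ^ t := Real.rpow_nonneg (by nlinarith [hr.1]) _
          have h6 : 0 ≤ N ^ (-s) := by positivity
          calc r * ((1 - r ^ 2) ^ t * N ^ (-s)) ≤ 1 * ((1 - r ^ 2) ^ t * N ^ (-s)) :=
                mul_le_mul_of_nonneg_right hr.2.le (by positivity)
            _ = (1 - r ^ 2) ^ t * N ^ (-s) := one_mul _
            _ ≤ (2 ^ |t| * (1 - r) ^ t) * ((4 * π) ^ s * (|θ| + (1 - ρ * r)) ^ (-s)) := by gcongr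
            _ = _ := by ring
      _ ≤ ENNReal.ofReal (K * (1 - r) ^ t) *
            (2 * ENNReal.ofReal (C₁ * (1 - ρ * r) ^ (-(s - 1)))) := by
          rw [lintegral_const_mul' _ _ ENNReal.ofReal_ne_top]
          refine mul_le_mul_right ((setLIntegral_comp_abs_le (fun x => ENNReal.ofReal
            (x ^ (0 : ℝ) * (x + (1 - ρ * r)) ^ (-(1 + 0 + (s - 1))))) _).trans ?_) _
          exact mul_le_mul_right (H₁ _ hδ) _
      _ ≤ _ := by
          have h2 : (2 : ℝ≥0∞) = ENNReal.ofReal 2 := by simp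
          -- Since 1-ρr dominates both 1-r and 1-ρ, it dominates their mean.
          have h3 : (1 - ρ * r) ^ (-(s - 1))
              ≤ 2 ^ (s - 1) * ((1 - r) + (1 - ρ)) ^ (-(1 + t + c)) := by
            calc (1 - ρ * r) ^ (-(s - 1)) ≤ (((1 - r) + (1 - ρ)) / 2) ^ (-(s - 1)) :=
                  Real.rpow_le_rpow_of_nonpos (by linarith) (by nlinarith [hr.1, hr.2]) (by linarith)
              _ = _ := by
                  rw [Real.div_rpow (by linarith) (by positivity),
                    Real.rpow_neg (by positivity : (0 : ℝ) ≤ 2),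
                    show -(s - 1) = -(1 + t + c) by rw [hs]; ring]
                  field_simp
          rw [h2, ← ENNReal.ofReal_mul (by positivity), ← ENNReal.ofReal_mul (by positivity),
            ← ENNReal.ofReal_mul (by positivity)]
          apply ENNReal.ofReal_le_ofReal
          calc K * (1 - r) ^ t * (2 * (C₁ * (1 - ρ * r) ^ (-(s - 1))))
              ≤ K * (1 - r) ^ t *
                (2 * (C₁ * (2 ^ (s - 1) * ((1 - r) + (1 - ρ)) ^ (-(1 + t + c))))) := by gcongr
            _ = _ := by ring
  calc _ ≤ ∫⁻ r in Ioo (0 : ℝ) 1, ENNReal.ofReal (K * 2 * C₁ * 2 ^ (s - 1)) *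
        ENNReal.ofReal ((1 - r) ^ t * ((1 - r) + (1 - ρ)) ^ (-(1 + t + c))) :=
        setLIntegral_mono' measurableSet_Ioo inner
    _ = ENNReal.ofReal (K * 2 * C₁ * 2 ^ (s - 1)) * ∫⁻ x in Ioo (0 : ℝ) 1,
        ENNReal.ofReal (x ^ t * (x + (1 - ρ)) ^ (-(1 + t + c))) := by
        rw [lintegral_const_mul' _ _ ENNReal.ofReal_ne_top]
        congr 1
        rw [← (Measure.measurePreserving_sub_left (volume : Measure ℝ)
          1).setLIntegral_comp_preimage_emb (Homeomorph.subLeft (1 : ℝ)).measurableEmbedding]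
        simp
    _ ≤ ENNReal.ofReal (K * 2 * C₁ * 2 ^ (s - 1)) * ENNReal.ofReal (C₂ * (1 - ρ) ^ (-c)) :=
        mul_le_mul_right ((lintegral_mono_set fun x hx => hx.1).trans (H₂ _ (by linarith))) _
    _ = _ := by
        rw [← ENNReal.ofReal_mul (by positivity)]
        congr 1
        ring

/-- The Forelli–Rudin estimate on the unit disc. -/
theorem exists_lintegral_kernel_le {t c : ℝ} (ht : -1 < t) (hc : 0 < c) :
    ∃ C : ℝ, 0 ≤ C ∧ ∀ z : ℂ, ‖z‖ < 1 →
      ∫⁻ w, ENNReal.ofReal ((1 - ‖w‖ ^ 2) ^ t * ‖1 - z * conj w‖ ^ (-(2 + t + c))) ∂discArea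
        ≤ ENNReal.ofReal (C * (1 - ‖z‖ ^ 2) ^ (-c)) := by
  obtain ⟨C, hC, H⟩ := exists_lintegral_kernel_le_of_real ht hc
  refine ⟨C * 2 ^ c, by positivity, fun z hz => ?_⟩
  obtain ⟨u, hu, hzu⟩ : ∃ u : ℂ, ‖u‖ = 1 ∧ z = u * ‖z‖ := by
    rcases eq_or_ne z 0 with rfl | h
    · exact ⟨1, by simp, by simp⟩
    · exact ⟨z / ‖z‖, by simp [h], (div_mul_cancel₀ z (by simpa using h)).symm⟩
  have hmp := measurePreserving_mul_discArea hu
  rw [← hmp.lintegral_comp (measurable_kernelNorm _ _ _)]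
  have huu : u * conj u = 1 := by rw [Complex.mul_conj', hu]; simp
  have h1 : ∀ w : ℂ, z * conj (u * w) = (‖z‖ : ℂ) * conj w := by
    intro w
    nth_rewrite 1 [hzu]
    rw [map_mul]
    linear_combination (‖z‖ : ℂ) * conj w * huu
  simp only [h1, norm_mul, hu, one_mul]
  refine (H ‖z‖ (norm_nonneg z) hz).trans (ENNReal.ofReal_le_ofReal ?_)
  rw [mul_assoc]
  refine mul_le_mul_of_nonneg_left ?_ hC
  have h2 : 0 < 1 - ‖z‖ ^ 2 := by nlinarith [norm_nonneg z]
  calc (1 - ‖z‖) ^ (-c) ≤ ((1 - ‖z‖ ^ 2) / 2) ^ (-c) :=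
        Real.rpow_le_rpow_of_nonpos (by positivity) (by nlinarith [norm_nonneg z]) (by linarith)
    _ = _ := by
        rw [Real.div_rpow h2.le (by positivity), Real.rpow_neg (by positivity : (0 : ℝ) ≤ 2)]
        field_simp

/-! ### Schur's test for the invariant measure. -/

/-- Jensen's inequality for the measure `k v dμ` and the function `h / v`. -/
theorem lintegral_mul_rpow_le {X : Type*} [MeasurableSpace X] {μ : Measure X} {p : ℝ} (hp : 1 ≤ p)
    {k v h : X → ℝ≥0∞} (hk : AEMeasurable k μ) (hv : AEMeasurable v μ) (hh : AEMeasurable h μ)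
    (hkt : ∀ᵐ x ∂μ, k x ≠ ∞) (hv0 : ∀ᵐ x ∂μ, v x ≠ 0) (hvt : ∀ᵐ x ∂μ, v x ≠ ∞) :
    (∫⁻ x, k x * h x ∂μ) ^ p ≤
      (∫⁻ x, k x * v x ∂μ) ^ (p - 1) * ∫⁻ x, k x * v x ^ (1 - p) * h x ^ p ∂μ := by
  have hp0 : 0 < p := by linarith
  set ν := μ.withDensity (fun x => k x * v x) with hν
  have hkv : AEMeasurable (fun x => k x * v x) μ := hk.mul hv
  have hkvt : ∀ᵐ x ∂μ, k x * v x < ∞ := by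
    filter_upwards [hkt, hvt] with x h1 h2
    exact ENNReal.mul_lt_top h1.lt_top h2.lt_top
  have hg : AEMeasurable (fun x => h x / v x) μ := hh.div hv
  have hgν : AEMeasurable (fun x => h x / v x) ν := hg.mono_ac (withDensity_absolutelyContinuous _ _)
  -- The measure is not normalized, so comparing the L¹ and L^p norms costs its mass to the power
  -- 1-1/p; this becomes p-1 after raising to the power p.
  have main := eLpNorm'_le_eLpNorm'_mul_rpow_measure_univ (μ := ν) (f := fun x => h x / v x)
    one_pos hp hgν.aestronglyMeasurable
  simp only [eLpNorm', enorm_eq_self, ENNReal.rpow_one, div_one] at main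
  have e1 : ∫⁻ x, h x / v x ∂ν = ∫⁻ x, k x * h x ∂μ := by
    rw [hν, lintegral_withDensity_eq_lintegral_mul_non_measurable₀ _ hkv hkvt]
    refine lintegral_congr_ae ?_
    filter_upwards [hv0, hvt] with x h1 h2
    simp only [Pi.mul_apply]
    rw [mul_assoc, ENNReal.mul_div_cancel h1 h2]
  have e2 : ∫⁻ x, (h x / v x) ^ p ∂ν = ∫⁻ x, k x * v x ^ (1 - p) * h x ^ p ∂μ := by
    rw [hν, lintegral_withDensity_eq_lintegral_mul_non_measurable₀ _ hkv hkvt]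
    refine lintegral_congr_ae ?_
    filter_upwards [hv0, hvt] with x h1 h2
    simp only [Pi.mul_apply]
    rw [ENNReal.div_rpow_of_nonneg _ _ hp0.le, ENNReal.rpow_sub _ _ h1 h2, ENNReal.rpow_one,
      div_eq_mul_inv, div_eq_mul_inv]
    ring
  have e3 : ν univ = ∫⁻ x, k x * v x ∂μ := by
    rw [hν, withDensity_apply _ MeasurableSet.univ, Measure.restrict_univ]
  rw [e1, e2, e3] at main
  calc _ ≤ ((∫⁻ x, k x * v x ^ (1 - p) * h x ^ p ∂μ) ^ (1 / p) *
        (∫⁻ x, k x * v x ∂μ) ^ (1 - 1 / p)) ^ p := by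
        refine ENNReal.rpow_le_rpow ?_ hp0.le
        simpa using main
    _ = _ := by
        rw [ENNReal.mul_rpow_of_nonneg _ _ hp0.le, ← ENNReal.rpow_mul, ← ENNReal.rpow_mul,
          one_div_mul_cancel hp0.ne', ENNReal.rpow_one, mul_comm]
        congr 2
        field_simp

/-- The Möbius invariant measure of the complex unit disc. -/
noncomputable def discHyp : Measure ℂ :=
  discArea.withDensity (fun z => ENNReal.ofReal (((1 - ‖z‖ ^ 2) ^ 2)⁻¹))

theorem ae_discHyp_mem_ball : ∀ᵐ w ∂discHyp, ‖w‖ < 1 :=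
  (withDensity_absolutelyContinuous _ _).ae_le ae_discArea_mem_ball

theorem lintegral_discHyp (g : ℂ → ℝ≥0∞) :
    ∫⁻ z, g z ∂discHyp = ∫⁻ z, ENNReal.ofReal (((1 - ‖z‖ ^ 2) ^ 2)⁻¹) * g z ∂discArea := by
  rw [discHyp, lintegral_withDensity_eq_lintegral_mul_non_measurable _ (by fun_prop) (by simp)]
  rfl

instance : SFinite discHyp := by unfold discHyp; infer_instance

/-- The kernel `(1-|z|²)^a (1-|w|²)^b / |1 - z w̄|^(a+b)` on the disc. -/
noncomputable def discKernel (a b : ℝ) (z w : ℂ) : ℝ≥0∞ :=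
  ENNReal.ofReal ((1 - ‖z‖ ^ 2) ^ a * (1 - ‖w‖ ^ 2) ^ b * ‖1 - z * conj w‖ ^ (-(a + b)))

theorem measurable_discKernel (a b : ℝ) : Measurable (Function.uncurry (discKernel a b)) := by
  unfold discKernel Function.uncurry
  fun_prop

theorem measurable_discKernel_right (a b : ℝ) (z : ℂ) : Measurable (discKernel a b z) := by
  unfold discKernel
  fun_prop

/-- Because of this symmetry, integrating in z obeys the same estimate as integrating in w, with a
and b interchanged. -/
theorem discKernel_comm (a b : ℝ) (z w : ℂ) : discKernel a b z w = discKernel b a w z := by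
  unfold discKernel
  rw [← Complex.norm_conj (1 - w * conj z)]
  simp only [map_sub, map_one, map_mul, Complex.conj_conj]
  rw [mul_comm (conj w) z, add_comm b a]
  ring_nf

theorem one_sub_norm_sq_pos {z : ℂ} (hz : ‖z‖ < 1) : 0 < 1 - ‖z‖ ^ 2 := by
  nlinarith [norm_nonneg z]

/-- The weight `(1-|z|²)^τ`. -/
noncomputable def discWeight (τ : ℝ) (z : ℂ) : ℝ≥0∞ := ENNReal.ofReal ((1 - ‖z‖ ^ 2) ^ τ)

theorem measurable_discWeight (τ : ℝ) : Measurable (discWeight τ) := by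
  unfold discWeight
  fun_prop

theorem discWeight_ne_zero (τ : ℝ) {z : ℂ} (hz : ‖z‖ < 1) : discWeight τ z ≠ 0 := by
  have := one_sub_norm_sq_pos hz
  simp only [discWeight, ne_eq, ENNReal.ofReal_eq_zero, not_le]
  positivity

theorem discWeight_rpow (τ s : ℝ) {z : ℂ} (hz : ‖z‖ < 1) :
    discWeight τ z ^ s = discWeight (τ * s) z := by
  have := one_sub_norm_sq_pos hz
  rw [discWeight, ENNReal.ofReal_rpow_of_pos (by positivity), discWeight, Real.rpow_mul this.le]

theorem discWeight_mul (τ s : ℝ) {z : ℂ} (hz : ‖z‖ < 1) :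
    discWeight τ z * discWeight s z = discWeight (τ + s) z := by
  have := one_sub_norm_sq_pos hz
  rw [discWeight, discWeight, discWeight, ← ENNReal.ofReal_mul (by positivity), Real.rpow_add this]

/-- Forelli–Rudin with t = b+τ-2 and c = a-τ, for which 2+t+c = a+b; the -2 comes from the density
of dλ. The powers of 1-|z|² thus serve as test functions for Schur's test. -/
theorem exists_lintegral_discKernel_le {a b τ : ℝ} (h1 : 1 < b + τ) (h2 : τ < a) :
    ∃ C : ℝ≥0∞, C ≠ ∞ ∧ ∀ z : ℂ, ‖z‖ < 1 →
      ∫⁻ w, discKernel a b z w * discWeight τ w ∂discHyp ≤ C * discWeight τ z := by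
  obtain ⟨C, hC, H⟩ := exists_lintegral_kernel_le (t := b + τ - 2) (c := a - τ)
    (by linarith) (by linarith)
  refine ⟨ENNReal.ofReal C, ENNReal.ofReal_ne_top, fun z hz => ?_⟩
  have hz' := one_sub_norm_sq_pos hz
  rw [lintegral_discHyp]
  calc _ = ∫⁻ w, ENNReal.ofReal ((1 - ‖z‖ ^ 2) ^ a) * ENNReal.ofReal ((1 - ‖w‖ ^ 2) ^ (b + τ - 2) *
        ‖1 - z * conj w‖ ^ (-(2 + (b + τ - 2) + (a - τ)))) ∂discArea := by
        refine lintegral_congr_ae ?_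
        filter_upwards [ae_discArea_mem_ball] with w hw
        have hw' := one_sub_norm_sq_pos hw
        unfold discKernel discWeight
        rw [← ENNReal.ofReal_mul (by positivity), ← ENNReal.ofReal_mul (by positivity),
          ← ENNReal.ofReal_mul (by positivity)]
        congr 1
        rw [Real.rpow_sub hw', Real.rpow_add hw', show 2 + (b + τ - 2) + (a - τ) = a + b by ring,
          Real.rpow_two]
        field_simp
    _ ≤ ENNReal.ofReal ((1 - ‖z‖ ^ 2) ^ a) * ENNReal.ofReal (C * (1 - ‖z‖ ^ 2) ^ (-(a - τ))) := by
        rw [lintegral_const_mul' _ _ ENNReal.ofReal_ne_top]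
        exact mul_le_mul_right (H z hz) _
    _ = _ := by
        rw [discWeight, ← ENNReal.ofReal_mul (by positivity), ← ENNReal.ofReal_mul (by positivity)]
        congr 1
        rw [mul_left_comm, ← Real.rpow_add hz']
        congr 2
        ring

theorem aemeasurable_weight_mul_discKernel_mul {a b p : ℝ} (τ : ℝ) {v h : ℂ → ℝ≥0∞}
    (hv : Measurable v) (hh : AEMeasurable h discHyp) :
    AEMeasurable (Function.uncurry fun z w =>
      discWeight τ z * (discKernel a b z w * v w * h w ^ p)) (discHyp.prod discHyp) := by
  have h1 : Measurable fun x : ℂ × ℂ => discWeight τ x.1 * (discKernel a b x.1 x.2 * v x.2) :=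
    ((measurable_discWeight _).comp measurable_fst).mul
      ((measurable_discKernel a b).mul (hv.comp measurable_snd))
  have h2 : AEMeasurable (fun x : ℂ × ℂ => h x.2 ^ p) (discHyp.prod discHyp) :=
    (hh.comp_quasiMeasurePreserving Measure.quasiMeasurePreserving_snd).pow_const p
  refine (h1.aemeasurable.mul h2).congr (Filter.Eventually.of_forall fun x => ?_)
  simp only [Function.uncurry, Pi.mul_apply]
  ring

/-- The integral operator with kernel `discKernel a b` is bounded on `L^p(discHyp)`. -/
theorem exists_lintegral_discKernel_rpow_le {a b p : ℝ} (hp : 1 ≤ p) (ha : 1 < a * p) (hb : 1 < b) :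
    ∃ C : ℝ≥0∞, C ≠ ∞ ∧ ∀ h : ℂ → ℝ≥0∞, AEMeasurable h discHyp →
      ∫⁻ z, (∫⁻ w, discKernel a b z w * h w ∂discHyp) ^ p ∂discHyp
        ≤ C * ∫⁻ w, h w ^ p ∂discHyp := by
  have hp0 : 0 < p := by linarith
  have hip : 0 < 1 / p := by positivity
  have hip1 : 1 / p ≤ 1 := by rw [div_le_one hp0]; exact hp
  have hap : 1 / p < a := by rw [div_lt_iff₀ hp0]; exact ha
  have hpp : 1 / p * (p - 1) = 1 - 1 / p := by field_simp
  -- The test function is v = (1-|z|²)^{1/p} for the integral in w, and v^{p-1} for the one in z.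
  -- Both exponents are admissible because 1/p < a and 1 < b.
  obtain ⟨C₁, hC₁, H₁⟩ := exists_lintegral_discKernel_le (a := a) (b := b) (τ := 1 / p)
    (by linarith) hap
  obtain ⟨C₂, hC₂, H₂⟩ := exists_lintegral_discKernel_le (a := b) (b := a) (τ := 1 / p * (p - 1))
    (by linarith) (by linarith)
  have hp1 : 0 ≤ p - 1 := by linarith
  refine ⟨C₁ ^ (p - 1) * C₂, ENNReal.mul_ne_top (ENNReal.rpow_ne_top_of_nonneg hp1 hC₁) hC₂,
    fun h hh => ?_⟩
  set v := discWeight (1 / p) with hv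
  calc _ ≤ ∫⁻ z, C₁ ^ (p - 1) * ∫⁻ w, discWeight (1 / p * (p - 1)) z *
        (discKernel a b z w * v w ^ (1 - p) * h w ^ p) ∂discHyp ∂discHyp := by
        refine lintegral_mono_ae ?_
        filter_upwards [ae_discHyp_mem_ball] with z hz
        refine (lintegral_mul_rpow_le hp (measurable_discKernel_right a b z).aemeasurable
          (measurable_discWeight (1 / p)).aemeasurable hh (by simp [discKernel]) ?_
          (by simp [discWeight])).trans ?_
        · filter_upwards [ae_discHyp_mem_ball] with w hw using discWeight_ne_zero _ hw
        · rw [lintegral_const_mul' _ _ (by simp [discWeight]), ← mul_assoc, ← discWeight_rpow _ _ hz,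
            ← ENNReal.mul_rpow_of_nonneg _ _ hp1]
          gcongr
          exact H₁ z hz
    _ = C₁ ^ (p - 1) * ∫⁻ w, ∫⁻ z, discWeight (1 / p * (p - 1)) z *
        (discKernel a b z w * v w ^ (1 - p) * h w ^ p) ∂discHyp ∂discHyp := by
        rw [lintegral_const_mul' _ _ (ENNReal.rpow_ne_top_of_nonneg hp1 hC₁), lintegral_lintegral_swap]
        exact aemeasurable_weight_mul_discKernel_mul _ ((measurable_discWeight _).pow_const _) hh
    _ ≤ C₁ ^ (p - 1) * ∫⁻ w, C₂ * h w ^ p ∂discHyp := by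
        refine mul_le_mul_right (lintegral_mono_ae ?_) _
        filter_upwards [ae_discHyp_mem_ball] with w hw
        calc _ = ∫⁻ z, (v w ^ (1 - p) * h w ^ p) *
              (discKernel b a w z * discWeight (1 / p * (p - 1)) z) ∂discHyp := by
              refine lintegral_congr fun z => ?_
              rw [discKernel_comm]
              ring
          _ = (v w ^ (1 - p) * h w ^ p) *
              ∫⁻ z, discKernel b a w z * discWeight (1 / p * (p - 1)) z ∂discHyp := by
              rw [lintegral_const_mul]
              exact (measurable_discKernel_right b a w).mul
                (measurable_discWeight _)
          _ ≤ (v w ^ (1 - p) * h w ^ p) * (C₂ * discWeight (1 / p * (p - 1)) w) :=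
              mul_le_mul_right (H₂ w hw) _
          _ = C₂ * h w ^ p * (discWeight (1 / p * (1 - p)) w * discWeight (1 / p * (p - 1)) w) := by
              rw [discWeight_rpow _ _ hw]
              ring
          _ = C₂ * h w ^ p := by
              rw [discWeight_mul _ _ hw, show 1 / p * (1 - p) + 1 / p * (p - 1) = 0 by ring]
              simp [discWeight]
    _ = _ := by rw [lintegral_const_mul' _ _ hC₂, mul_assoc]

/-- Functions in `L^p(discHyp)` are integrable against `(1-|w|²)^b dλ(w)` for `b > 1`. -/
theorem lintegral_discWeight_mul_lt_top {b p : ℝ} (hp : 1 ≤ p) (hb : 1 < b) {h : ℂ → ℝ≥0∞}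
    (hh : AEMeasurable h discHyp) (hfin : ∫⁻ w, h w ^ p ∂discHyp < ∞) :
    ∫⁻ w, discWeight b w * h w ∂discHyp < ∞ := by
  have hp0 : 0 < p := by linarith
  have hip : 0 < 1 / p := by positivity
  have hp1 : 0 ≤ p - 1 := by linarith
  have hpp : 1 / p * (1 - p) = 1 / p - 1 := by field_simp
  -- At z = 0 the kernel is the weight alone, so a plays no role beyond exceeding τ = 1/p.
  obtain ⟨C₁, hC₁, H₁⟩ := exists_lintegral_discKernel_le (a := 1 / p + 1) (b := b) (τ := 1 / p)
    (by linarith) (by linarith)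
  have hK : ∀ w, discKernel (1 / p + 1) b 0 w = discWeight b w := by
    simp [discKernel, discWeight]
  have H := H₁ 0 (by simp)
  simp only [hK] at H
  have J := lintegral_mul_rpow_le (μ := discHyp) hp (measurable_discWeight b).aemeasurable
    (measurable_discWeight (1 / p)).aemeasurable hh (by simp [discWeight])
    (by filter_upwards [ae_discHyp_mem_ball] with w hw using discWeight_ne_zero _ hw)
    (by simp [discWeight])
  have h2 : ∫⁻ w, discWeight b w * discWeight (1 / p) w ^ (1 - p) * h w ^ p ∂discHyp < ∞ := by
    refine lt_of_le_of_lt (lintegral_mono_ae ?_) hfin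
    filter_upwards [ae_discHyp_mem_ball] with w hw
    rw [discWeight_rpow _ _ hw, discWeight_mul _ _ hw]
    refine (mul_le_mul_left (?_ : _ ≤ (1 : ℝ≥0∞)) _).trans (one_mul _).le
    have := one_sub_norm_sq_pos hw
    rw [discWeight, ENNReal.ofReal_le_one]
    exact Real.rpow_le_one this.le (by nlinarith [sq_nonneg ‖w‖]) (by linarith)
  have h3 := J.trans_lt (ENNReal.mul_lt_top (ENNReal.rpow_lt_top_of_nonneg hp1
    (ne_top_of_le_ne_top (ENNReal.mul_ne_top hC₁ (by simp [discWeight])) H)) h2)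
  exact (ENNReal.rpow_lt_top_iff_of_pos hp0).1 h3

/-! ### The Bergman operator and its derivatives. -/

/-- The measure `(α + 1) (1 - |z|²)^α dA` on the complex unit disc. -/
noncomputable def discWeighted (α : ℝ) : Measure ℂ :=
  discArea.withDensity (fun z => ENNReal.ofReal ((α + 1) * (1 - ‖z‖ ^ 2) ^ α))

theorem ae_discWeighted_mem_ball (α : ℝ) : ∀ᵐ w ∂discWeighted α, ‖w‖ < 1 :=
  (withDensity_absolutelyContinuous _ _).ae_le ae_discArea_mem_ball

theorem discWeighted_absolutelyContinuous (α : ℝ) : discWeighted α ≪ discHyp := by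
  refine (withDensity_absolutelyContinuous _ _).trans (withDensity_absolutelyContinuous' ?_ ?_)
  · fun_prop
  · filter_upwards [ae_discArea_mem_ball] with w hw
    have := one_sub_norm_sq_pos hw
    simp only [ne_eq, ENNReal.ofReal_eq_zero, not_le]
    positivity

/-- With respect to dλ the weight gains two powers, which is why the kernel exponent b is α+2. -/
theorem lintegral_discWeighted {α : ℝ} (hα : -1 < α) (g : ℂ → ℝ≥0∞) :
    ∫⁻ w, g w ∂discWeighted α
      = ENNReal.ofReal (α + 1) * ∫⁻ w, discWeight (α + 2) w * g w ∂discHyp := by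
  rw [lintegral_discHyp, discWeighted,
    lintegral_withDensity_eq_lintegral_mul_non_measurable _ (by fun_prop) (by simp),
    ← lintegral_const_mul' _ _ ENNReal.ofReal_ne_top]
  refine lintegral_congr_ae ?_
  filter_upwards [ae_discArea_mem_ball] with w hw
  have hw' := one_sub_norm_sq_pos hw
  have h1 : 0 < α + 1 := by linarith
  simp only [Pi.mul_apply, discWeight]
  rw [← mul_assoc, ← mul_assoc, ← ENNReal.ofReal_mul (by positivity),
    ← ENNReal.ofReal_mul (by positivity), Real.rpow_add hw', Real.rpow_two]
  congr 2
  field_simp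

section

variable {E : Type*} [NormedAddCommGroup E]

theorem integrable_discWeighted_of_memLp {α p : ℝ} (hα : -1 < α) (hp : 1 ≤ p) {h : ℂ → E}
    (hh : MemLp h (ENNReal.ofReal p) discHyp) : Integrable h (discWeighted α) := by
  have hp0 : 0 < p := by linarith
  refine ⟨hh.1.mono_ac (discWeighted_absolutelyContinuous α), ?_⟩
  rw [hasFiniteIntegral_iff_enorm, lintegral_discWeighted hα]
  refine ENNReal.mul_lt_top ENNReal.ofReal_lt_top
    (lintegral_discWeight_mul_lt_top hp (by linarith) hh.1.enorm ?_)
  have := lintegral_rpow_enorm_lt_top_of_eLpNorm_lt_top (by simpa using hp0) (by simp) hh.2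
  rwa [ENNReal.toReal_ofReal hp0.le] at this

theorem one_sub_norm_le_norm_one_sub_mul_conj {z w : ℂ} (hw : ‖w‖ ≤ 1) :
    1 - ‖z‖ ≤ ‖1 - z * conj w‖ := by
  have h1 : ‖z * conj w‖ ≤ ‖z‖ := by
    rw [norm_mul, Complex.norm_conj]
    exact mul_le_of_le_one_right (norm_nonneg _) hw
  have h2 := norm_sub_norm_le (1 : ℂ) (z * conj w)
  rw [norm_one] at h2
  linarith

theorem one_sub_mul_conj_mem_slitPlane {z w : ℂ} (hz : ‖z‖ < 1) (hw : ‖w‖ ≤ 1) :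
    1 - z * conj w ∈ Complex.slitPlane := by
  rw [sub_eq_add_neg]
  apply Complex.mem_slitPlane_of_norm_lt_one
  rw [norm_neg, norm_mul, Complex.norm_conj]
  exact (mul_le_of_le_one_right (norm_nonneg _) hw).trans_lt hz

theorem norm_one_sub_mul_conj_cpow_le {z w : ℂ} {s δ : ℝ} (hs : 0 ≤ s) (hδ : 0 < δ)
    (hz : ‖z‖ ≤ 1 - δ) (hw : ‖w‖ ≤ 1) : ‖(1 - z * conj w) ^ (-(s : ℂ))‖ ≤ δ ^ (-s) := by
  rw [← Complex.ofReal_neg, Complex.norm_cpow_real]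
  refine Real.rpow_le_rpow_of_nonpos hδ ?_ (by linarith)
  have := one_sub_norm_le_norm_one_sub_mul_conj (z := z) hw
  linarith

theorem measurable_one_sub_mul_conj_cpow (z c : ℂ) :
    Measurable fun w : ℂ => (1 - z * conj w) ^ c := by
  fun_prop

variable [NormedSpace ℂ E]

theorem integrable_kernel_smul {μ : Measure ℂ} (hμ : ∀ᵐ w ∂μ, ‖w‖ < 1) {φ : ℂ → E}
    (hφ : Integrable φ μ) {s : ℝ} (hs : 0 ≤ s) {z : ℂ} (hz : ‖z‖ < 1) :
    Integrable (fun w => (1 - z * conj w) ^ (-(s : ℂ)) • φ w) μ := by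
  refine hφ.bdd_smul ((1 - ‖z‖) ^ (-s)) (measurable_one_sub_mul_conj_cpow z _).aestronglyMeasurable ?_
  filter_upwards [hμ] with w hw
  exact norm_one_sub_mul_conj_cpow_le hs (by linarith) (by linarith) hw.le

theorem integrable_conj_pow_smul {μ : Measure ℂ} (hμ : ∀ᵐ w ∂μ, ‖w‖ < 1) {φ : ℂ → E}
    (hφ : Integrable φ μ) (k : ℕ) : Integrable (fun w => conj w ^ k • φ w) μ := by
  refine hφ.bdd_smul 1 (by fun_prop) ?_
  filter_upwards [hμ] with w hw
  rw [norm_pow, Complex.norm_conj]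
  exact pow_le_one₀ (norm_nonneg _) hw.le

/-- Dominated differentiation: on the ball of radius δ = (1-|z|)/2 about z one has |1-xw̄| ≥ δ, and
1-xw̄ stays in the slit plane, where the principal power is holomorphic. -/
theorem hasDerivAt_integral_kernel {μ : Measure ℂ} (hμ : ∀ᵐ w ∂μ, ‖w‖ < 1) {φ : ℂ → E}
    (hφ : Integrable φ μ) {s : ℝ} (hs : 0 ≤ s) {z : ℂ} (hz : ‖z‖ < 1) :
    HasDerivAt (fun x => ∫ w, (1 - x * conj w) ^ (-(s : ℂ)) • φ w ∂μ)
      ((s : ℂ) • ∫ w, (1 - z * conj w) ^ (-((s + 1 : ℝ) : ℂ)) • conj w • φ w ∂μ) z := by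
  set δ := (1 - ‖z‖) / 2 with hδ
  have hδ0 : 0 < δ := by rw [hδ]; linarith
  have hball : ∀ x ∈ Metric.ball z δ, ‖x‖ ≤ 1 - δ := by
    intro x hx
    have h1 := norm_le_norm_add_norm_sub' x z
    rw [Metric.mem_ball, dist_eq_norm] at hx
    have : ‖z‖ = 1 - 2 * δ := by rw [hδ]; ring
    linarith
  have hae : ∀ x, AEStronglyMeasurable (fun w => (1 - x * conj w) ^ (-(s : ℂ)) • φ w) μ := fun x =>
    (measurable_one_sub_mul_conj_cpow x _).aestronglyMeasurable.smul hφ.1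
  have hF' : ∀ x, AEStronglyMeasurable (fun w =>
      (s : ℂ) • (1 - x * conj w) ^ (-((s + 1 : ℝ) : ℂ)) • conj w • φ w) μ := fun x =>
    ((measurable_one_sub_mul_conj_cpow x _).aestronglyMeasurable.smul
      ((Complex.continuous_conj.measurable.aestronglyMeasurable).smul hφ.1)).const_smul _
  have := hasDerivAt_integral_of_dominated_loc_of_deriv_le (𝕜 := ℂ) (x₀ := z)
    (F' := fun x w => (s : ℂ) • (1 - x * conj w) ^ (-((s + 1 : ℝ) : ℂ)) • conj w • φ w)
    (bound := fun w => s * δ ^ (-(s + 1)) * ‖φ w‖) (Metric.ball_mem_nhds z hδ0)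
    (Filter.Eventually.of_forall hae) (integrable_kernel_smul hμ hφ hs hz) (hF' z)
    (by
      filter_upwards [hμ] with w hw x hx
      have h1 := norm_one_sub_mul_conj_cpow_le (s := s + 1) (by linarith) hδ0 (hball x hx) hw.le
      rw [norm_smul, norm_smul, norm_smul, Complex.norm_real, Real.norm_of_nonneg hs,
        Complex.norm_conj, mul_assoc s]
      refine mul_le_mul_of_nonneg_left (mul_le_mul h1 ?_ (by positivity) (by positivity)) hs
      exact mul_le_of_le_one_left (norm_nonneg _) hw.le)
    (hφ.norm.const_mul _)
    (by
      filter_upwards [hμ] with w hw x hx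
      have hx1 : ‖x‖ < 1 := (hball x hx).trans_lt (by linarith)
      have h1 : HasDerivAt (fun x : ℂ => 1 - x * conj w) (-conj w) x := by
        simpa using ((hasDerivAt_id x).mul_const (conj w)).const_sub 1
      have h2 := (h1.cpow_const (c := -(s : ℂ))
        (one_sub_mul_conj_mem_slitPlane hx1 hw.le)).smul_const (φ w)
      convert! h2 using 1
      rw [smul_smul, smul_smul]
      congr 1
      push_cast
      rw [show -((s : ℂ) + 1) = -s - 1 by ring]
      ring)
  rw [← integral_smul]
  exact this.2

/-- Each derivative raises the exponent by one and multiplies the density by w̄; the factors s, s+1,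
… build up the rising factorial. -/
theorem iteratedDeriv_integral_kernel {μ : Measure ℂ} (hμ : ∀ᵐ w ∂μ, ‖w‖ < 1) {φ : ℂ → E}
    (hφ : Integrable φ μ) {s : ℝ} (hs : 0 ≤ s) (n : ℕ) {z : ℂ} (hz : ‖z‖ < 1) :
    iteratedDeriv n (fun x => ∫ w, (1 - x * conj w) ^ (-(s : ℂ)) • φ w ∂μ) z
      = (((ascPochhammer ℝ n).eval s : ℝ) : ℂ) •
        ∫ w, (1 - z * conj w) ^ (-((s + n : ℝ) : ℂ)) • conj w ^ n • φ w ∂μ := by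
  induction n generalizing z with
  | zero => simp
  | succ n ih =>
    rw [iteratedDeriv_succ]
    have h1 : iteratedDeriv n (fun x => ∫ w, (1 - x * conj w) ^ (-(s : ℂ)) • φ w ∂μ) =ᶠ[nhds z]
        fun z => (((ascPochhammer ℝ n).eval s : ℝ) : ℂ) •
          ∫ w, (1 - z * conj w) ^ (-((s + n : ℝ) : ℂ)) • conj w ^ n • φ w ∂μ := by
      filter_upwards [Metric.isOpen_ball.mem_nhds (mem_ball_zero_iff.2 hz)] with x hx
      exact ih (mem_ball_zero_iff.1 hx)
    rw [h1.deriv_eq]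
    have h2 := (hasDerivAt_integral_kernel hμ (integrable_conj_pow_smul hμ hφ n)
      (s := s + n) (by positivity) hz).const_smul (((ascPochhammer ℝ n).eval s : ℝ) : ℂ)
    refine h2.deriv.trans ?_
    rw [smul_smul, ascPochhammer_succ_eval]
    push_cast
    simp only [smul_smul, pow_succ', add_assoc]

/-- The weighted Bergman integral operator of the complex unit disc. -/
noncomputable def discProj (α : ℝ) (h : ℂ → E) (z : ℂ) : E :=
  ∫ w, (1 - z * conj w) ^ (-((2 + α : ℝ) : ℂ)) • h w ∂discWeighted α

theorem differentiableOn_discProj {α : ℝ} (hα : -1 < α) {h : ℂ → E}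
    (hh : Integrable h (discWeighted α)) :
    DifferentiableOn ℂ (discProj α h) (Metric.ball 0 1) := fun _ hz =>
  (hasDerivAt_integral_kernel (ae_discWeighted_mem_ball α) hh (by linarith : 0 ≤ 2 + α)
    (mem_ball_zero_iff.1 hz)).differentiableAt.differentiableWithinAt

/-- After the trivial bound |w̄ⁿ| ≤ 1, the weighted n-th derivative is dominated by the kernel
operator with a = n and b = α+2, so that np > 1 is precisely the hypothesis of Schur's test. -/
theorem lintegral_iteratedDeriv_discProj_lt_top {α p : ℝ} (hα : -1 < α) (hp : 1 ≤ p) {n : ℕ}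
    (hn : 1 < n * p) {h : ℂ → E} (hh : MemLp h (ENNReal.ofReal p) discHyp) :
    ∫⁻ z, (discWeight n z * ‖iteratedDeriv n (discProj α h) z‖ₑ) ^ p ∂discHyp < ∞ := by
  have hp0 : 0 < p := by linarith
  have hint := integrable_discWeighted_of_memLp hα hp hh
  obtain ⟨C, hC, H⟩ := exists_lintegral_discKernel_rpow_le (a := n) (b := α + 2) hp hn (by linarith)
  set A : ℝ≥0∞ := ‖(((ascPochhammer ℝ n).eval (2 + α) : ℝ) : ℂ)‖ₑ * ENNReal.ofReal (α + 1) with hA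
  have hAt : A ≠ ∞ := ENNReal.mul_ne_top enorm_ne_top ENNReal.ofReal_ne_top
  have hfin := lintegral_rpow_enorm_lt_top_of_eLpNorm_lt_top (by simpa using hp0) (by simp) hh.2
  rw [ENNReal.toReal_ofReal hp0.le] at hfin
  have key : ∀ z : ℂ, ‖z‖ < 1 → discWeight n z * ‖iteratedDeriv n (discProj α h) z‖ₑ
      ≤ A * ∫⁻ w, discKernel n (α + 2) z w * ‖h w‖ₑ ∂discHyp := by
    intro z hz
    have hz' := one_sub_norm_sq_pos hz
    unfold discProj
    rw [iteratedDeriv_integral_kernel (ae_discWeighted_mem_ball α) hint (by linarith) n hz, enorm_smul,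
      hA, mul_left_comm, mul_assoc]
    refine mul_le_mul_right ?_ _
    calc _ ≤ discWeight n z * ∫⁻ w, ENNReal.ofReal (‖1 - z * conj w‖ ^ (-(2 + α + n))) * ‖h w‖ₑ
          ∂discWeighted α := by
          refine mul_le_mul_right ((enorm_integral_le_lintegral_enorm _).trans
            (lintegral_mono_ae ?_)) _
          filter_upwards [ae_discWeighted_mem_ball α] with w hw
          rw [enorm_smul, enorm_smul, ← ofReal_norm, ← Complex.ofReal_neg,
            Complex.norm_cpow_real]
          refine mul_le_mul_right (?_ : _ ≤ ‖h w‖ₑ) _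
          calc ‖conj w ^ n‖ₑ * ‖h w‖ₑ ≤ 1 * ‖h w‖ₑ := by
                refine mul_le_mul_left ?_ _
                rw [← ofReal_norm, ENNReal.ofReal_le_one, norm_pow, Complex.norm_conj]
                exact pow_le_one₀ (norm_nonneg _) hw.le
            _ = _ := one_mul _
      _ = ENNReal.ofReal (α + 1) * ∫⁻ w, discWeight n z * (discWeight (α + 2) w *
            (ENNReal.ofReal (‖1 - z * conj w‖ ^ (-(2 + α + n))) * ‖h w‖ₑ)) ∂discHyp := by
          rw [lintegral_discWeighted hα, mul_left_comm,
            lintegral_const_mul' _ _ (by simp [discWeight])]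
      _ = _ := by
          congr 1
          refine lintegral_congr_ae ?_
          filter_upwards [ae_discHyp_mem_ball] with w hw
          have hw' := one_sub_norm_sq_pos hw
          rw [← mul_assoc, ← mul_assoc]
          congr 1
          rw [discWeight, discWeight, discKernel, ← ENNReal.ofReal_mul (by positivity),
            ← ENNReal.ofReal_mul (by positivity), show (2 + α + n : ℝ) = n + (α + 2) by ring]
  calc _ ≤ ∫⁻ z, A ^ p * (∫⁻ w, discKernel n (α + 2) z w * ‖h w‖ₑ ∂discHyp) ^ p ∂discHyp := by
        refine lintegral_mono_ae ?_
        filter_upwards [ae_discHyp_mem_ball] with z hz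
        rw [← ENNReal.mul_rpow_of_nonneg _ _ hp0.le]
        exact ENNReal.rpow_le_rpow (key z hz) hp0.le
    _ ≤ A ^ p * (C * ∫⁻ w, ‖h w‖ₑ ^ p ∂discHyp) := by
        rw [lintegral_const_mul' _ _ (ENNReal.rpow_ne_top_of_nonneg hp0.le hAt)]
        exact mul_le_mul_right (H _ hh.1.enorm) _
    _ < ∞ := ENNReal.mul_lt_top (ENNReal.rpow_lt_top_of_nonneg hp0.le hAt)
        (ENNReal.mul_lt_top hC.lt_top hfin)

end

/-! ### Circle averages and radial moments. -/

section

variable {E : Type*} [NormedAddCommGroup E] [NormedSpace ℂ E] [CompleteSpace E]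

/-- Rotations preserve the area measure; averaging over all of them and applying Fubini reduces
moments to integrals over circles. -/
theorem integral_discArea_eq_integral_average {g : ℂ → E} (hg : Integrable g discArea) :
    ∫ w, g w ∂discArea
      = (2 * π)⁻¹ • ∫ w, (∫ θ in (0 : ℝ)..2 * π, g (circleMap 0 1 θ * w)) ∂discArea := by
  have hmp : ∀ θ : ℝ, MeasurePreserving (fun w => circleMap 0 1 θ * w) discArea discArea := fun θ =>
    measurePreserving_mul_discArea (by simp)
  have hpi : (0 : ℝ) ≤ 2 * π := by positivity
  set ν := (volume : Measure ℝ).restrict (Ioc 0 (2 * π)) with hν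
  have hq : Measure.QuasiMeasurePreserving (fun x : ℝ × ℂ => circleMap 0 1 x.1 * x.2)
      (ν.prod discArea) discArea :=
    QuasiMeasurePreserving.prod_of_right
      (by unfold circleMap; fun_prop) (Filter.Eventually.of_forall fun θ => (hmp θ).quasiMeasurePreserving)
  have hae : AEStronglyMeasurable (fun x : ℝ × ℂ => g (circleMap 0 1 x.1 * x.2))
      (ν.prod discArea) := hg.1.comp_quasiMeasurePreserving hq
  have hint : Integrable (fun x : ℝ × ℂ => g (circleMap 0 1 x.1 * x.2)) (ν.prod discArea) := by
    refine ⟨hae, ?_⟩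
    rw [hasFiniteIntegral_iff_enorm, lintegral_prod _ hae.enorm]
    have : ∀ θ : ℝ, ∫⁻ w, ‖g (circleMap 0 1 θ * w)‖ₑ ∂discArea = ∫⁻ w, ‖g w‖ₑ ∂discArea := fun θ =>
      (hmp θ).lintegral_comp_emb (Homeomorph.mulLeft₀ _ (by simp)).measurableEmbedding
        (fun w => ‖g w‖ₑ)
    simp only [this, lintegral_const]
    refine ENNReal.mul_lt_top (hasFiniteIntegral_iff_enorm.1 hg.2) (measure_lt_top _ _)
  have h1 : ∀ θ : ℝ, ∫ w, g (circleMap 0 1 θ * w) ∂discArea = ∫ w, g w ∂discArea := fun θ =>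
    (hmp θ).integral_comp (Homeomorph.mulLeft₀ _ (by simp)).measurableEmbedding g
  have h2 := integral_integral_swap (f := fun θ w => g (circleMap 0 1 θ * w)) hint
  simp only [h1, integral_const] at h2
  simp only [intervalIntegral.integral_of_le hpi]
  rw [← hν, ← h2, smul_smul]
  have h3 : ν.real univ = 2 * π := by
    simp [hν, Measure.real, Real.pi_pos.le]
  rw [h3, inv_mul_cancel₀ (by positivity), one_smul]

/-- Cauchy's coefficient formula for ζ ↦ u(ζw), with 1/ζ = ζ̄ on the unit circle; uniqueness of
power series identifies its k-th coefficient as wᵏaₖ. -/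
theorem integral_circle_conj_pow_smul {u : ℂ → E} (hu : DifferentiableOn ℂ u (Metric.ball 0 1))
    {a : ℕ → E} (ha : ∀ w ∈ Metric.ball (0 : ℂ) 1, HasSum (fun j => w ^ j • a j) (u w)) (k : ℕ)
    {w : ℂ} (hw : ‖w‖ < 1) :
    ∫ θ in (0 : ℝ)..2 * π, conj (circleMap 0 1 θ * w) ^ k • u (circleMap 0 1 θ * w)
      = ((2 * π * ‖w‖ ^ (2 * k) : ℝ) : ℂ) • a k := by
  set v : ℂ → E := fun ζ => u (ζ * w) with hv
  have hball : ∀ ζ : ℂ, ‖ζ‖ ≤ 1 → ζ * w ∈ Metric.ball (0 : ℂ) 1 := by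
    intro ζ hζ
    rw [mem_ball_zero_iff, norm_mul]
    exact (mul_le_of_le_one_left (norm_nonneg _) hζ).trans_lt hw
  have hd : DifferentiableOn ℂ v (Metric.closedBall 0 (1 : NNReal)) := by
    refine hu.comp (by fun_prop) fun ζ hζ => hball ζ ?_
    simpa using hζ
  have h1 := (hd.hasFPowerSeriesOnBall one_pos).hasFPowerSeriesAt
  let q : FormalMultilinearSeries ℂ ℂ E :=
    fun j => ContinuousMultilinearMap.mkPiRing ℂ (Fin j) (w ^ j • a j)
  have h2 : HasFPowerSeriesAt v q 0 := by
    refine hasFPowerSeriesAt_iff.2 ?_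
    filter_upwards [Metric.ball_mem_nhds (0 : ℂ) one_pos] with ζ hζ
    have := ha _ (hball ζ (by simpa using (mem_ball_zero_iff.1 hζ).le))
    simp only [q, FormalMultilinearSeries.coeff, zero_add, ContinuousMultilinearMap.mkPiRing_apply]
    simpa [mul_pow, mul_smul, hv] using this
  have h3 := congrArg (fun p => (p k) fun _ => (1 : ℂ)) (h1.eq_formalMultilinearSeries h2)
  simp only [q, cauchyPowerSeries_apply, ContinuousMultilinearMap.mkPiRing_apply] at h3
  simp only [circleIntegral, Finset.prod_const_one, one_smul, deriv_circleMap, sub_zero, NNReal.coe_one] at h3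
  have h4 : ∀ θ : ℝ, (circleMap 0 1 θ * Complex.I) • (1 / circleMap 0 1 θ) ^ k •
      (circleMap 0 1 θ)⁻¹ • v (circleMap 0 1 θ)
      = Complex.I • (conj (circleMap 0 1 θ) ^ k • u (circleMap 0 1 θ * w)) := by
    intro θ
    have hne : circleMap 0 1 θ ≠ 0 := by simp
    have hc : 1 / circleMap 0 1 θ = conj (circleMap 0 1 θ) := by
      rw [div_eq_iff hne, mul_comm, Complex.mul_conj']
      simp
    rw [hc, smul_smul, smul_smul, smul_smul]
    congr 1
    field_simp
  simp only [h4, intervalIntegral.integral_smul] at h3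
  have h5 : ∫ θ in (0 : ℝ)..2 * π, conj (circleMap 0 1 θ) ^ k • u (circleMap 0 1 θ * w)
      = (2 * π : ℂ) • w ^ k • a k := by
    rw [← h3, smul_smul, smul_smul]
    have : (2 * (π : ℂ) * (2 * π * Complex.I)⁻¹ * Complex.I) = 1 := by
      have : (π : ℂ) ≠ 0 := by simp
      field_simp [Complex.I_ne_zero]
    rw [this, one_smul]
  simp only [map_mul, mul_pow, mul_comm _ (conj w ^ k), mul_smul, intervalIntegral.integral_smul]
  rw [h5, smul_smul, smul_smul]
  congr 1
  have : w ^ k * conj w ^ k = (‖w‖ : ℂ) ^ (2 * k) := by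
    rw [← mul_pow, Complex.mul_conj', pow_mul]
  push_cast
  rw [← this]
  ring

/-- Moments of a holomorphic function against a radial weight. -/
theorem integral_radial_mul_conj_pow_smul {u : ℂ → E} (hu : DifferentiableOn ℂ u (Metric.ball 0 1))
    {a : ℕ → E} (ha : ∀ w ∈ Metric.ball (0 : ℂ) 1, HasSum (fun j => w ^ j • a j) (u w)) (k : ℕ)
    (ρ : ℝ → ℝ) (hint : Integrable (fun w => (ρ ‖w‖ : ℂ) • conj w ^ k • u w) discArea) :
    ∫ w, (ρ ‖w‖ : ℂ) • conj w ^ k • u w ∂discArea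
      = ((∫ w, ρ ‖w‖ * ‖w‖ ^ (2 * k) ∂discArea : ℝ) : ℂ) • a k := by
  rw [integral_discArea_eq_integral_average hint, ← integral_complex_ofReal, ← integral_smul_const,
    ← integral_smul]
  refine integral_congr_ae ?_
  filter_upwards [ae_discArea_mem_ball] with w hw
  simp only [norm_mul, norm_circleMap_zero, abs_one, one_mul, intervalIntegral.integral_smul]
  rw [integral_circle_conj_pow_smul hu ha k hw, ← Complex.coe_smul, smul_smul, smul_smul]
  congr 1
  have : (π : ℂ) ≠ 0 := by simp
  push_cast
  field_simp

end

theorem lintegral_one_sub_sq_rpow {β : ℝ} (hβ : -1 < β) :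
    ∫⁻ w, ENNReal.ofReal ((1 - ‖w‖ ^ 2) ^ β) ∂discArea = ENNReal.ofReal (1 / (β + 1)) := by
  have hβ1 : 0 < β + 1 := by linarith
  rw [lintegral_discArea _ (by fun_prop)]
  have h1 : ∀ r ∈ Ioo (0 : ℝ) 1, ∫⁻ θ in Ioo (-π) π, ENNReal.ofReal r * ENNReal.ofReal
      ((1 - ‖(r : ℂ) * (Real.cos θ + Real.sin θ * Complex.I)‖ ^ 2) ^ β)
      = ENNReal.ofReal (2 * π) * ENNReal.ofReal (r * (1 - r ^ 2) ^ β) := by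
    intro r hr
    have hn : ∀ θ : ℝ, ‖(r : ℂ) * (Real.cos θ + Real.sin θ * Complex.I)‖ = r := fun θ => by
      rw [norm_mul, Complex.ofReal_cos, Complex.ofReal_sin, Complex.norm_cos_add_sin_mul_I,
        Complex.norm_real, Real.norm_of_nonneg hr.1.le, mul_one]
    simp only [hn, lintegral_const, Measure.restrict_apply_univ, Real.volume_Ioo]
    rw [← ENNReal.ofReal_mul hr.1.le, mul_comm, show π - -π = 2 * π by ring]
  rw [setLIntegral_congr_fun measurableSet_Ioo h1, lintegral_const_mul' _ _ ENNReal.ofReal_ne_top]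
  set G : ℝ → ℝ := fun r => -(1 - r ^ 2) ^ (β + 1) / (2 * (β + 1)) with hG
  have hcont : ContinuousOn G (Icc 0 1) := by
    apply Continuous.continuousOn
    refine (Continuous.neg ?_).div_const _
    exact Continuous.rpow_const (by fun_prop) fun _ => Or.inr hβ1.le
  have hder : ∀ r ∈ Ioo (0 : ℝ) 1, HasDerivAt G (r * (1 - r ^ 2) ^ β) r := by
    intro r hr
    have h2 : HasDerivAt (fun r : ℝ => 1 - r ^ 2) (-(2 * r)) r := by
      simpa using (hasDerivAt_pow 2 r).const_sub 1
    have h3 := ((h2.rpow_const (p := β + 1)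
      (Or.inl (by nlinarith [hr.1, hr.2]))).neg).div_const (2 * (β + 1))
    convert! h3 using 1
    rw [add_sub_cancel_right]
    field_simp
  have hpos : ∀ r ∈ Ioo (0 : ℝ) 1, 0 ≤ r * (1 - r ^ 2) ^ β := fun r hr =>
    mul_nonneg hr.1.le (Real.rpow_nonneg (by nlinarith [hr.1, hr.2]) _)
  have hint := intervalIntegral.integrableOn_deriv_of_nonneg hcont hder hpos
  have hval := intervalIntegral.integral_eq_sub_of_hasDerivAt_of_le zero_le_one hcont hder
    ((intervalIntegrable_iff_integrableOn_Ioc_of_le zero_le_one).2 hint)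
  rw [← ofReal_integral_eq_lintegral_ofReal (hint.mono_set Ioo_subset_Ioc_self)
    (by filter_upwards [ae_restrict_mem measurableSet_Ioo] with r hr using hpos r hr),
    ← integral_Ioc_eq_integral_Ioo, ← intervalIntegral.integral_of_le zero_le_one, hval,
    ← ENNReal.ofReal_mul (by positivity), ← ENNReal.ofReal_mul (by positivity)]
  congr 1
  simp only [hG]
  norm_num [Real.zero_rpow hβ1.ne']
  field_simp

theorem integrable_one_sub_sq_rpow_mul_pow {β : ℝ} (hβ : -1 < β) (m : ℕ) :
    Integrable (fun w : ℂ => (1 - ‖w‖ ^ 2) ^ β * ‖w‖ ^ (2 * m)) discArea := by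
  have h0 : Integrable (fun w : ℂ => (1 - ‖w‖ ^ 2) ^ β) discArea := by
    refine ⟨Measurable.aestronglyMeasurable (by fun_prop), ?_⟩
    rw [hasFiniteIntegral_iff_ofReal, lintegral_one_sub_sq_rpow hβ]
    · exact ENNReal.ofReal_lt_top
    · filter_upwards [ae_discArea_mem_ball] with w hw
      exact Real.rpow_nonneg (one_sub_norm_sq_pos hw).le _
  refine h0.mul_bdd (c := 1) (by fun_prop) ?_
  filter_upwards [ae_discArea_mem_ball] with w hw
  rw [norm_pow, norm_norm]
  exact pow_le_one₀ (norm_nonneg _) hw.le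

/-- A Beta integral, by induction from |w|² = 1-(1-|w|²), which trades a power of |w|² for a shift
of β. The rising factorial is unrolled from the right in one term and from the left in the other. -/
theorem integral_one_sub_sq_rpow_mul_pow {β : ℝ} (hβ : -1 < β) (m : ℕ) :
    (∫ w : ℂ, (1 - ‖w‖ ^ 2) ^ β * ‖w‖ ^ (2 * m) ∂discArea) * (ascPochhammer ℝ (m + 1)).eval (β + 1)
      = m.factorial := by
  induction m generalizing β with
  | zero =>
    have hβ1 : 0 < β + 1 := by linarith
    simp only [mul_zero, pow_zero, mul_one, zero_add, ascPochhammer_one, Polynomial.eval_X,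
      Nat.factorial_zero, Nat.cast_one]
    rw [integral_eq_lintegral_of_nonneg_ae _ (Measurable.aestronglyMeasurable (by fun_prop)), lintegral_one_sub_sq_rpow hβ,
      ENNReal.toReal_ofReal (by positivity)]
    · field_simp
    · filter_upwards [ae_discArea_mem_ball] with w hw
      exact Real.rpow_nonneg (one_sub_norm_sq_pos hw).le _
  | succ m ih =>
    have hβ1 : -1 < β + 1 := by linarith
    have h1 : ∫ w : ℂ, (1 - ‖w‖ ^ 2) ^ β * ‖w‖ ^ (2 * (m + 1)) ∂discArea
        = (∫ w : ℂ, (1 - ‖w‖ ^ 2) ^ β * ‖w‖ ^ (2 * m) ∂discArea)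
          - ∫ w : ℂ, (1 - ‖w‖ ^ 2) ^ (β + 1) * ‖w‖ ^ (2 * m) ∂discArea := by
      rw [← integral_sub (integrable_one_sub_sq_rpow_mul_pow hβ m)
        (integrable_one_sub_sq_rpow_mul_pow hβ1 m)]
      refine integral_congr_ae ?_
      filter_upwards [ae_discArea_mem_ball] with w hw
      rw [Real.rpow_add_one (one_sub_norm_sq_pos hw).ne']
      ring
    have i1 := ih hβ
    have i2 := ih hβ1
    have e1 : (ascPochhammer ℝ (m + 1 + 1)).eval (β + 1)
        = (ascPochhammer ℝ (m + 1)).eval (β + 1) * (β + 1 + (m + 1 : ℕ)) := ascPochhammer_succ_eval _ _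
    have e2 : (ascPochhammer ℝ (m + 1 + 1)).eval (β + 1)
        = (β + 1) * (ascPochhammer ℝ (m + 1)).eval (β + 1 + 1) := by
      rw [ascPochhammer_succ_left]
      simp
    rw [h1, sub_mul]
    nth_rewrite 1 [e1]
    rw [e2, ← mul_assoc, i1, mul_left_comm, i2, Nat.factorial_succ]
    push_cast
    ring

/-! ### Membership in L^p(dλ) and weighted Taylor moments. -/

section

variable {E : Type*} [NormedAddCommGroup E]

theorem aestronglyMeasurable_discHyp {u : ℂ → E} (hu : ContinuousOn u (Metric.ball 0 1)) :
    AEStronglyMeasurable u discHyp := by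
  refine (hu.aestronglyMeasurable Metric.isOpen_ball.measurableSet (μ := volume)).mono_ac ?_
  exact (withDensity_absolutelyContinuous _ _).trans Measure.smul_absolutelyContinuous

/-- The integral of (1-|w|²)^{np} dλ is finite because np > 1; it is the kernel estimate at z = 0
with τ = 0. This puts bounded functions times (1-|w|²)ⁿ in L^p(dλ). -/
theorem memLp_one_sub_sq_pow {p : ℝ} (hp : 1 ≤ p) {n : ℕ} (hn : 1 < n * p) :
    MemLp (fun w : ℂ => (1 - ‖w‖ ^ 2) ^ n) (ENNReal.ofReal p) discHyp := by
  have hp0 : 0 < p := by linarith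
  refine ⟨Measurable.aestronglyMeasurable (by fun_prop), ?_⟩
  rw [eLpNorm_lt_top_iff_lintegral_rpow_enorm_lt_top (by simpa using hp0) (by simp),
    ENNReal.toReal_ofReal hp0.le]
  obtain ⟨C, hC, H⟩ := exists_lintegral_discKernel_le (a := 1) (b := n * p) (τ := 0)
    (by linarith) (by norm_num)
  have H0 := H 0 (by simp)
  refine lt_of_le_of_lt (le_of_eq_of_le ?_ H0) (by simpa [discWeight] using hC.lt_top)
  refine lintegral_congr_ae ?_
  filter_upwards [ae_discHyp_mem_ball] with w hw
  have hw' := one_sub_norm_sq_pos hw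
  rw [← ofReal_norm, Real.norm_of_nonneg (by positivity), ENNReal.ofReal_rpow_of_pos (by positivity),
    ← Real.rpow_natCast, ← Real.rpow_mul hw'.le]
  simp [discKernel, discWeight]

theorem memLp_of_norm_le_pow {p : ℝ} (hp : 1 ≤ p) {n : ℕ} (hn : 1 < n * p) {g u : ℂ → E}
    (hg : AEStronglyMeasurable g discHyp)
    (hfin : ∫⁻ z, (discWeight n z * ‖g z‖ₑ) ^ p ∂discHyp < ∞)
    (hu : AEStronglyMeasurable u discHyp) {C : ℝ}
    (hC : ∀ w, ‖w‖ < 1 → ‖u w‖ ≤ C * ((1 - ‖w‖ ^ 2) ^ n * (1 + ‖g w‖))) :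
    MemLp u (ENNReal.ofReal p) discHyp := by
  have hp0 : 0 < p := by linarith
  have h1 := memLp_one_sub_sq_pow hp hn
  have h2 : MemLp (fun w => (1 - ‖w‖ ^ 2) ^ n * ‖g w‖) (ENNReal.ofReal p) discHyp := by
    refine ⟨h1.1.mul hg.norm, ?_⟩
    rw [eLpNorm_lt_top_iff_lintegral_rpow_enorm_lt_top (by simpa using hp0) (by simp),
      ENNReal.toReal_ofReal hp0.le]
    refine lt_of_eq_of_lt (lintegral_congr_ae ?_) hfin
    filter_upwards [ae_discHyp_mem_ball] with w hw
    have hw' := one_sub_norm_sq_pos hw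
    rw [enorm_mul, enorm_norm, discWeight, Real.rpow_natCast, ← ofReal_norm,
      Real.norm_of_nonneg (by positivity)]
  refine ((h1.add h2).const_mul C).mono' hu ?_
  filter_upwards [ae_discHyp_mem_ball] with w hw
  refine (hC w hw).trans (le_of_eq ?_)
  simp only [Pi.add_apply]
  ring

variable [NormedSpace ℂ E]

theorem withDensity_weight_toReal {α : ℝ} (hα : -1 < α) {w : ℂ} (hw : ‖w‖ < 1) :
    (ENNReal.ofReal ((α + 1) * (1 - ‖w‖ ^ 2) ^ α)).toReal = (α + 1) * (1 - ‖w‖ ^ 2) ^ α := by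
  have hw' := one_sub_norm_sq_pos hw
  have : 0 < α + 1 := by linarith
  exact ENNReal.toReal_ofReal (by positivity)

theorem integral_discWeighted {α : ℝ} (hα : -1 < α) (φ : ℂ → E) :
    ∫ w, φ w ∂discWeighted α
      = ∫ w, (((α + 1) * (1 - ‖w‖ ^ 2) ^ α : ℝ) : ℂ) • φ w ∂discArea := by
  rw [discWeighted, integral_withDensity_eq_integral_toReal_smul (by fun_prop) (by simp)]
  refine integral_congr_ae ?_
  filter_upwards [ae_discArea_mem_ball] with w hw
  rw [withDensity_weight_toReal hα hw, Complex.coe_smul]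

theorem integrable_discWeighted_iff {α : ℝ} (hα : -1 < α) (φ : ℂ → E) :
    Integrable φ (discWeighted α) ↔
      Integrable (fun w => (((α + 1) * (1 - ‖w‖ ^ 2) ^ α : ℝ) : ℂ) • φ w) discArea := by
  rw [discWeighted, integrable_withDensity_iff_integrable_smul' (by fun_prop) (by simp)]
  refine integrable_congr ?_
  filter_upwards [ae_discArea_mem_ball] with w hw
  rw [withDensity_weight_toReal hα hw, Complex.coe_smul]

theorem ae_discArea_ne_zero : ∀ᵐ w ∂discArea, w ≠ 0 := by
  refine Measure.ae_smul_measure ?_ _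
  exact ae_restrict_of_ae (by simp [ae_iff])

theorem ae_discWeighted_ne_zero (α : ℝ) : ∀ᵐ w ∂discWeighted α, w ≠ 0 :=
  (withDensity_absolutelyContinuous _ _).ae_le ae_discArea_ne_zero

theorem hasFPowerSeriesAt_of_hasSum {u : ℂ → E} {a : ℕ → E}
    (ha : ∀ w ∈ Metric.ball (0 : ℂ) 1, HasSum (fun j => w ^ j • a j) (u w)) :
    HasFPowerSeriesAt (𝕜 := ℂ) (E := ℂ) u
      (fun j => ContinuousMultilinearMap.mkPiRing ℂ (Fin j) (a j)) 0 := by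
  refine hasFPowerSeriesAt_iff.2 ?_
  filter_upwards [Metric.ball_mem_nhds (0 : ℂ) one_pos] with ζ hζ
  simpa [FormalMultilinearSeries.coeff] using ha ζ hζ

/-- The partial sum in Taylor's estimate vanishes. This makes division by w̄ⁿ harmless at the
origin. -/
theorem isBigO_pow_of_hasSum {u : ℂ → E} {a : ℕ → E}
    (ha : ∀ w ∈ Metric.ball (0 : ℂ) 1, HasSum (fun j => w ^ j • a j) (u w)) {n : ℕ}
    (h0 : ∀ j < n, a j = 0) : u =O[nhds 0] fun w => ‖w‖ ^ n := by
  have h := (hasFPowerSeriesAt_of_hasSum ha).isBigO_sub_partialSum_pow n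
  have hz : ∀ y : ℂ, FormalMultilinearSeries.partialSum (𝕜 := ℂ) (E := ℂ)
      (fun j => ContinuousMultilinearMap.mkPiRing ℂ (Fin j) (a j)) n y = 0 := by
    intro y
    refine Finset.sum_eq_zero fun j hj => ?_
    simp [h0 j (Finset.mem_range.1 hj)]
  simpa [hz] using h

variable [CompleteSpace E]

theorem hasSum_taylor {u : ℂ → E} (hu : DifferentiableOn ℂ u (Metric.ball 0 1)) :
    ∀ w ∈ Metric.ball (0 : ℂ) 1,
      HasSum (fun j : ℕ => w ^ j • (j.factorial : ℂ)⁻¹ • iteratedDeriv j u 0) (u w) := by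
  intro w hw
  have := Complex.hasSum_taylorSeries_on_ball hu hw
  simp only [sub_zero] at this
  exact (funext fun j => smul_comm _ _ _ : (fun j : ℕ => w ^ j • (j.factorial : ℂ)⁻¹ •
    iteratedDeriv j u 0) = _) ▸ this

theorem eqOn_ball_of_iteratedDeriv_eq {u v : ℂ → E} (hu : DifferentiableOn ℂ u (Metric.ball 0 1))
    (hv : DifferentiableOn ℂ v (Metric.ball 0 1))
    (h : ∀ k, iteratedDeriv k u 0 = iteratedDeriv k v 0) : EqOn u v (Metric.ball 0 1) := by
  intro w hw
  have h1 := hasSum_taylor hu w hw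
  simp only [h] at h1
  exact h1.unique (hasSum_taylor hv w hw)

theorem differentiableOn_iteratedDeriv {u : ℂ → E} {s : Set ℂ} (hs : IsOpen s)
    (hu : DifferentiableOn ℂ u s) (n : ℕ) : DifferentiableOn ℂ (iteratedDeriv n u) s := by
  induction n with
  | zero => simpa using hu
  | succ n ih =>
    rw [iteratedDeriv_succ]
    exact ih.deriv hs

/-- Moments against `(1 - |w|²)^n dA_α`. -/
theorem integral_conj_pow_smul_weighted {α : ℝ} (hα : -1 < α) {u : ℂ → E}
    (hu : DifferentiableOn ℂ u (Metric.ball 0 1)) {a : ℕ → E}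
    (ha : ∀ w ∈ Metric.ball (0 : ℂ) 1, HasSum (fun j => w ^ j • a j) (u w)) (n k : ℕ)
    (hint : Integrable (fun w => ((1 - ‖w‖ ^ 2 : ℝ) : ℂ) ^ n • u w) (discWeighted α)) :
    ∫ w, conj w ^ k • ((1 - ‖w‖ ^ 2 : ℝ) : ℂ) ^ n • u w ∂discWeighted α
      = (((α + 1) * ∫ w : ℂ, (1 - ‖w‖ ^ 2) ^ (α + n) * ‖w‖ ^ (2 * k) ∂discArea : ℝ) : ℂ) • a k := by
  have hae : ∀ᵐ w ∂discArea, (((α + 1) * (1 - ‖w‖ ^ 2) ^ α : ℝ) : ℂ) •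
      conj w ^ k • ((1 - ‖w‖ ^ 2 : ℝ) : ℂ) ^ n • u w
      = (((fun r : ℝ => (α + 1) * (1 - r ^ 2) ^ (α + n)) ‖w‖ : ℝ) : ℂ) • conj w ^ k • u w := by
    filter_upwards [ae_discArea_mem_ball] with w hw
    have hw' := one_sub_norm_sq_pos hw
    simp only [Real.rpow_add hw', Real.rpow_natCast, smul_smul]
    congr 1
    push_cast
    ring
  have h1 := (integrable_discWeighted_iff hα _).1
    (integrable_conj_pow_smul (ae_discWeighted_mem_ball α) hint k)
  rw [integral_discWeighted hα, integral_congr_ae hae,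
    integral_radial_mul_conj_pow_smul hu ha k
      (fun r : ℝ => (α + 1) * (1 - r ^ 2) ^ (α + n)) (h1.congr hae)]
  congr 2
  rw [← integral_const_mul]
  simp only [mul_assoc]

/-- The low order moments of `(1 - |w|²)^n u(w) / w̄^n` vanish. -/
theorem integral_conj_pow_smul_weighted_inv_eq_zero {α : ℝ} (hα : -1 < α) {u : ℂ → E}
    (hu : DifferentiableOn ℂ u (Metric.ball 0 1)) {n k : ℕ} (hkn : k < n)
    (hint : Integrable (fun w => ((1 - ‖w‖ ^ 2 : ℝ) : ℂ) ^ n • (conj w ^ n)⁻¹ • u w)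
      (discWeighted α)) :
    ∫ w, conj w ^ k • ((1 - ‖w‖ ^ 2 : ℝ) : ℂ) ^ n • (conj w ^ n)⁻¹ • u w ∂discWeighted α = 0 := by
  -- Away from 0, w̄^{k-n} = w^{n-k}/|w|^{2(n-k)}. The integral is therefore a radial moment of
  -- order zero of w^{n-k}u, which vanishes at 0.
  set v : ℂ → E := fun w => w ^ (n - k) • u w with hv
  have hvd : DifferentiableOn ℂ v (Metric.ball 0 1) := by
    exact DifferentiableOn.smul (by fun_prop) hu
  have hae : ∀ᵐ w ∂discArea, (((α + 1) * (1 - ‖w‖ ^ 2) ^ α : ℝ) : ℂ) •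
      conj w ^ k • ((1 - ‖w‖ ^ 2 : ℝ) : ℂ) ^ n • (conj w ^ n)⁻¹ • u w
      = (((fun r : ℝ => (α + 1) * (1 - r ^ 2) ^ (α + n) * (r ^ (2 * (n - k)))⁻¹) ‖w‖ : ℝ) : ℂ) •
        conj w ^ 0 • v w := by
    filter_upwards [ae_discArea_mem_ball, ae_discArea_ne_zero] with w hw hw0
    have hw' := one_sub_norm_sq_pos hw
    simp only [hv, Real.rpow_add hw', Real.rpow_natCast, smul_smul]
    congr 1
    have hc0 : conj w ≠ 0 := by simpa using hw0
    have h1 : (‖w‖ : ℂ) ^ (2 * (n - k)) = w ^ (n - k) * conj w ^ (n - k) := by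
      rw [← mul_pow, Complex.mul_conj', pow_mul]
    have h2 : conj w ^ n = conj w ^ k * conj w ^ (n - k) := by
      rw [← pow_add]; congr 1; omega
    push_cast
    rw [h1, h2]
    field_simp
  have h1 := (integrable_discWeighted_iff hα _).1
    (integrable_conj_pow_smul (ae_discWeighted_mem_ball α) hint k)
  rw [integral_discWeighted hα, integral_congr_ae hae,
    integral_radial_mul_conj_pow_smul hvd (hasSum_taylor hvd) 0
      (fun r : ℝ => (α + 1) * (1 - r ^ 2) ^ (α + n) * (r ^ (2 * (n - k)))⁻¹) (h1.congr hae)]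
  have : n - k ≠ 0 := by omega
  simp [hv, this]

end

/-! ### Surjectivity of the Bergman operator on the disc. -/

section

variable {E : Type*} [NormedAddCommGroup E]

theorem exists_norm_le_of_continuousOn_ball {u : ℂ → E}
    (hu : ContinuousOn u (Metric.closedBall 0 1)) :
    ∃ C, 0 ≤ C ∧ ∀ w, ‖w‖ < 1 → ‖u w‖ ≤ C := by
  obtain ⟨C, hC⟩ := (isCompact_closedBall (0 : ℂ) 1).exists_bound_of_continuousOn hu
  refine ⟨C, (norm_nonneg _).trans (hC 0 (by simp)), fun w hw => hC w ?_⟩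
  simpa using hw.le

variable [NormedSpace ℂ E]

/-- Near 0 the vanishing order of u compensates w̄⁻ⁿ; outside a neighbourhood of 0 that factor is
bounded. -/
theorem exists_norm_inv_conj_pow_smul_le {u g : ℂ → E} {n : ℕ} {A : ℝ}
    (h0 : u =O[nhds 0] fun w => ‖w‖ ^ n) (hA : 0 ≤ A)
    (hug : ∀ w, ‖w‖ < 1 → ‖u w‖ ≤ A + ‖g w‖) :
    ∃ C, 0 ≤ C ∧ ∀ w, ‖w‖ < 1 → ‖(conj w ^ n)⁻¹ • u w‖ ≤ C * (1 + ‖g w‖) := by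
  obtain ⟨c, hc0, hc⟩ := h0.exists_nonneg
  obtain ⟨ε, hε, hball⟩ := Metric.eventually_nhds_iff_ball.1 hc.bound
  refine ⟨c + (ε ^ n)⁻¹ * (A + 1), by positivity, fun w hw => ?_⟩
  have hn : ‖(conj w ^ n)⁻¹ • u w‖ = (‖w‖ ^ n)⁻¹ * ‖u w‖ := by
    rw [norm_smul, norm_inv, norm_pow, Complex.norm_conj]
  rw [hn]
  have hg := norm_nonneg (g w)
  rcases lt_or_ge ‖w‖ ε with h | h
  · have h1 := hball w (by simpa using h)
    rw [norm_pow, norm_norm] at h1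
    calc (‖w‖ ^ n)⁻¹ * ‖u w‖ ≤ (‖w‖ ^ n)⁻¹ * (c * ‖w‖ ^ n) := by gcongr
      _ = c * ((‖w‖ ^ n)⁻¹ * ‖w‖ ^ n) := by ring
      -- Only an inequality, so that w = 0, where the inverse may be the default value 0, is
      -- included.
      _ ≤ c * 1 := mul_le_mul_of_nonneg_left inv_mul_le_one hc0
      _ ≤ (c + (ε ^ n)⁻¹ * (A + 1)) * 1 := by
          have : 0 ≤ (ε ^ n)⁻¹ * (A + 1) := by positivity
          linarith
      _ ≤ _ := mul_le_mul_of_nonneg_left (by linarith) (by positivity)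
  · calc (‖w‖ ^ n)⁻¹ * ‖u w‖ ≤ (ε ^ n)⁻¹ * (A + ‖g w‖) := by
          have := hug w hw
          gcongr
      _ ≤ (ε ^ n)⁻¹ * ((A + 1) * (1 + ‖g w‖)) := by
          gcongr
          nlinarith [mul_nonneg hA hg]
      _ ≤ c * (1 + ‖g w‖) + (ε ^ n)⁻¹ * ((A + 1) * (1 + ‖g w‖)) := by
          have : 0 ≤ c * (1 + ‖g w‖) := by positivity
          linarith
      _ = _ := by ring

variable [CompleteSpace E]

/-- Surjectivity of the Bergman operator: the holomorphic functions `F` with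
`(1 - |z|²)^n F^{(n)} ∈ L^p(dλ)` are of the form `P_α h` with `h ∈ L^p(dλ)`. -/
theorem exists_eqOn_discProj {α p : ℝ} (hα : -1 < α) (hp : 1 ≤ p) {n : ℕ} (hn : 1 < n * p)
    {F : ℂ → E} (hF : DifferentiableOn ℂ F (Metric.ball 0 1))
    (hfin : ∫⁻ z, (discWeight n z * ‖iteratedDeriv n F z‖ₑ) ^ p ∂discHyp < ∞) :
    ∃ h : ℂ → E, MemLp h (ENNReal.ofReal p) discHyp ∧ EqOn F (discProj α h) (Metric.ball 0 1) := by
  have hα1 : 0 < α + 1 := by linarith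
  have hαn : -1 < α + n := by have : (0 : ℝ) ≤ n := n.cast_nonneg; linarith
  set g := iteratedDeriv n F with hg
  have hgd : DifferentiableOn ℂ g (Metric.ball 0 1) :=
    differentiableOn_iteratedDeriv Metric.isOpen_ball hF n
  have hgk : ∀ m, iteratedDeriv m g 0 = iteratedDeriv (m + n) F 0 := by
    intro m
    rw [hg, iteratedDeriv_eq_iterate, iteratedDeriv_eq_iterate, iteratedDeriv_eq_iterate,
      Function.iterate_add_apply]
  set b : ℕ → E := fun m => (m.factorial : ℂ)⁻¹ • iteratedDeriv m g 0 with hb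
  have hgs : ∀ w ∈ Metric.ball (0 : ℂ) 1, HasSum (fun j => w ^ j • b j) (g w) := hasSum_taylor hgd
  -- the part of `g` of order at least `n`
  set T : ℂ → E := fun w => ∑ m ∈ Finset.range n, w ^ m • b m with hT
  have hTd : Differentiable ℂ T := by rw [hT]; fun_prop
  set u : ℂ → E := fun w => g w - T w with hu
  have hud : DifferentiableOn ℂ u (Metric.ball 0 1) := hgd.sub hTd.differentiableOn
  set b' : ℕ → E := fun m => if m < n then 0 else b m with hb'
  have hb'0 : ∀ m, m < n → b' m = 0 := fun m hm => if_pos hm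
  have hb'1 : ∀ m, n ≤ m → b' m = b m := fun m hm => if_neg (not_lt.2 hm)
  have hus : ∀ w ∈ Metric.ball (0 : ℂ) 1, HasSum (fun j => w ^ j • b' j) (u w) := by
    intro w hw
    have h1 : HasSum (fun j => w ^ j • (if j < n then b j else 0)) (T w) := by
      have : T w = ∑ j ∈ Finset.range n, w ^ j • (if j < n then b j else 0) :=
        Finset.sum_congr rfl fun j hj => by rw [if_pos (Finset.mem_range.1 hj)]
      rw [this]
      exact hasSum_sum_of_ne_finset_zero fun j hj => by
        rw [if_neg (by simpa using hj), smul_zero]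
    convert! (hgs w hw).sub h1 using 2 with j
    by_cases hj : j < n <;> simp [hb', hj]
  set M : ℕ → ℝ := fun k => (α + 1) * ∫ w : ℂ, (1 - ‖w‖ ^ 2) ^ (α + n) * ‖w‖ ^ (2 * k) ∂discArea
    with hM
  have hMk : ∀ k, M k * (ascPochhammer ℝ (k + 1)).eval (α + n + 1) = (α + 1) * k.factorial := by
    intro k
    rw [hM, mul_assoc, integral_one_sub_sq_rpow_mul_pow hαn]
  have hM0 : ∀ k, M k ≠ 0 := by
    intro k h
    have := hMk k
    rw [h, zero_mul] at this
    have h2 : (k.factorial : ℝ) ≠ 0 := by positivity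
    exact (mul_ne_zero hα1.ne' h2) this.symm
  have hA0 : ∀ k, (ascPochhammer ℝ k).eval (2 + α) ≠ 0 := fun k =>
    (ascPochhammer_pos k _ (by linarith)).ne'
  -- the polynomial part of `h`
  set d : ℕ → E := fun k => if k < 2 * n then
    ((((ascPochhammer ℝ k).eval (2 + α) * M k)⁻¹ : ℝ) : ℂ) • iteratedDeriv k F 0 else 0 with hd
  have hd0 : ∀ k, k < 2 * n → d k = ((((ascPochhammer ℝ k).eval (2 + α) * M k)⁻¹ : ℝ) : ℂ) •
    iteratedDeriv k F 0 := fun k hk => if_pos hk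
  have hd1 : ∀ k, 2 * n ≤ k → d k = 0 := fun k hk => if_neg (not_lt.2 hk)
  -- Orders below n of F are invisible in F⁽ⁿ⁾, and the orders from n to 2n-1 went away with `T`;
  -- hence the degree bound 2n. Each coefficient solves (2+α)ₖ Mₖ dₖ = F⁽ᵏ⁾(0), with rising
  -- factorial (2+α)ₖ.
  set P : ℂ → E := fun w => ∑ k ∈ Finset.range (2 * n), w ^ k • d k with hP
  have hPd : Differentiable ℂ P := by rw [hP]; fun_prop
  have hPs : ∀ w ∈ Metric.ball (0 : ℂ) 1, HasSum (fun j => w ^ j • d j) (P w) := by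
    intro w hw
    exact hasSum_sum_of_ne_finset_zero fun j hj => by
      rw [hd1 j (by simpa using hj), smul_zero]
  -- For k = n+m ≥ 2n the Taylor coefficients agree if (2+α)_{n+m} γ M_m = m!. As M_m = (α+1)
  -- m!/(α+n+1)_{m+1}, this forces γ = 1/(α+1)ₙ, which does not depend on m.
  set γ : ℝ := ((ascPochhammer ℝ n).eval (α + 1))⁻¹ with hγ
  set h₁ : ℂ → E := fun w => ((1 - ‖w‖ ^ 2 : ℝ) : ℂ) ^ n • P w with hh₁
  set h₂ : ℂ → E := fun w => ((1 - ‖w‖ ^ 2 : ℝ) : ℂ) ^ n • (conj w ^ n)⁻¹ • u w with hh₂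
  obtain ⟨CP, hCP0, hCP⟩ := exists_norm_le_of_continuousOn_ball hPd.continuous.continuousOn
  obtain ⟨CT, hCT0, hCT⟩ := exists_norm_le_of_continuousOn_ball hTd.continuous.continuousOn
  have hug : ∀ w, ‖w‖ < 1 → ‖u w‖ ≤ CT + ‖g w‖ := fun w hw =>
    (norm_sub_le _ _).trans (by have := hCT w hw; linarith)
  obtain ⟨C, hC0, hC⟩ := exists_norm_inv_conj_pow_smul_le
    (isBigO_pow_of_hasSum hus hb'0) hCT0 hug
  have hga : AEStronglyMeasurable g discHyp := aestronglyMeasurable_discHyp hgd.continuousOn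
  have hua : AEStronglyMeasurable u discHyp := aestronglyMeasurable_discHyp hud.continuousOn
  have hnorm : ∀ w : ℂ, ‖w‖ < 1 → ‖((1 - ‖w‖ ^ 2 : ℝ) : ℂ) ^ n‖ = (1 - ‖w‖ ^ 2) ^ n := by
    intro w hw
    rw [norm_pow, Complex.norm_real, Real.norm_of_nonneg (one_sub_norm_sq_pos hw).le]
  have hwm : Measurable fun w : ℂ => ((1 - ‖w‖ ^ 2 : ℝ) : ℂ) ^ n := by fun_prop
  have hL₁ : MemLp h₁ (ENNReal.ofReal p) discHyp := by
    refine memLp_of_norm_le_pow hp hn hga hfin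
      (hwm.aestronglyMeasurable.smul hPd.continuous.aestronglyMeasurable) (C := CP) fun w hw => ?_
    have := one_sub_norm_sq_pos hw
    rw [hh₁, norm_smul, hnorm w hw]
    calc _ ≤ (1 - ‖w‖ ^ 2) ^ n * CP := by gcongr; exact hCP w hw
      _ = CP * ((1 - ‖w‖ ^ 2) ^ n * (1 + 0)) := by ring
      _ ≤ _ := by gcongr; exact norm_nonneg _
  have hL₂ : MemLp h₂ (ENNReal.ofReal p) discHyp := by
    have hcm : Measurable fun w : ℂ => (conj w ^ n)⁻¹ := by fun_prop
    refine memLp_of_norm_le_pow hp hn hga hfin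
      (hwm.aestronglyMeasurable.smul (hcm.aestronglyMeasurable.smul hua)) (C := C) fun w hw => ?_
    have := one_sub_norm_sq_pos hw
    rw [hh₂, norm_smul, hnorm w hw, mul_left_comm]
    gcongr
    exact hC w hw
  have hL : MemLp (fun w => h₁ w + (γ : ℂ) • h₂ w) (ENNReal.ofReal p) discHyp :=
    hL₁.add (hL₂.const_smul (γ : ℂ))
  have hi₁ := integrable_discWeighted_of_memLp hα hp hL₁
  have hi₂ := integrable_discWeighted_of_memLp hα hp hL₂
  have hi := integrable_discWeighted_of_memLp hα hp hL
  have hae := ae_discWeighted_mem_ball α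
  refine ⟨fun w => h₁ w + (γ : ℂ) • h₂ w, hL,
    eqOn_ball_of_iteratedDeriv_eq hF (differentiableOn_discProj hα hi) fun k => ?_⟩
  have hmom : ∫ w, conj w ^ k • (h₁ w + (γ : ℂ) • h₂ w) ∂discWeighted α
      = (M k : ℂ) • d k + (γ : ℂ) • ∫ w, conj w ^ k • h₂ w ∂discWeighted α := by
    have hi₂' : Integrable (fun w => (γ : ℂ) • h₂ w) (discWeighted α) := hi₂.smul (γ : ℂ)
    simp only [smul_add]
    rw [integral_add (integrable_conj_pow_smul hae hi₁ k) (integrable_conj_pow_smul hae hi₂' k)]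
    congr 1
    · exact integral_conj_pow_smul_weighted hα hPd.differentiableOn hPs n k hi₁
    · rw [← integral_smul]
      exact integral_congr_ae (Filter.Eventually.of_forall fun w => smul_comm _ _ _)
  have hmom₂ : n ≤ k → ∫ w, conj w ^ k • h₂ w ∂discWeighted α = (M (k - n) : ℂ) • b' (k - n) := by
    intro hk
    have h1 : ∀ᵐ w ∂discWeighted α, conj w ^ n • h₂ w = ((1 - ‖w‖ ^ 2 : ℝ) : ℂ) ^ n • u w := by
      filter_upwards [ae_discWeighted_ne_zero α] with w hw0
      have : conj w ^ n ≠ 0 := pow_ne_zero _ (by simpa using hw0)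
      rw [hh₂, smul_comm, smul_smul (conj w ^ n), mul_inv_cancel₀ this, one_smul]
    have h2 := (integrable_conj_pow_smul hae hi₂ n).congr h1
    rw [← integral_conj_pow_smul_weighted hα hud hus n (k - n) h2]
    refine integral_congr_ae ?_
    filter_upwards [h1] with w hw
    have : conj w ^ k = conj w ^ (k - n) * conj w ^ n := by rw [← pow_add, Nat.sub_add_cancel hk]
    rw [← hw, this, mul_smul]
  have hlow : k < 2 * n → ∫ w, conj w ^ k • h₂ w ∂discWeighted α = 0 := by
    intro hk
    rcases lt_or_ge k n with h | h
    · exact integral_conj_pow_smul_weighted_inv_eq_zero hα hud h hi₂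
    · rw [hmom₂ h, hb'0 _ (by omega), smul_zero]
  unfold discProj
  rw [iteratedDeriv_integral_kernel hae hi (by linarith) k (by simp)]
  -- At the origin the kernel is 1, so only a conjugate moment of h remains.
  simp only [zero_mul, sub_zero, Complex.one_cpow, one_smul]
  rw [hmom]
  rcases lt_or_ge k (2 * n) with hk | hk
  · rw [hlow hk, smul_zero, add_zero, hd0 k hk, smul_smul, smul_smul, ← Complex.ofReal_mul,
      ← Complex.ofReal_mul]
    rw [mul_inv_cancel₀ (mul_ne_zero (hA0 k) (hM0 k)), Complex.ofReal_one, one_smul]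
  · obtain ⟨m, rfl⟩ : ∃ m, k = n + m := ⟨k - n, by omega⟩
    rw [hmom₂ (by omega), hd1 _ hk, smul_zero, zero_add, Nat.add_sub_cancel_left, hb'1 _ (by omega),
      show b m = (m.factorial : ℂ)⁻¹ • iteratedDeriv m g 0 from rfl, hgk, add_comm m n, smul_smul, smul_smul, smul_smul]
    have h1 : (ascPochhammer ℝ (n + m)).eval (2 + α) * (α + 1)
        = (ascPochhammer ℝ n).eval (α + 1) * (ascPochhammer ℝ (m + 1)).eval (α + n + 1) := by
      have e1 : (ascPochhammer ℝ (n + m + 1)).eval (α + 1)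
          = (α + 1) * (ascPochhammer ℝ (n + m)).eval (α + 1 + 1) := by
        rw [ascPochhammer_succ_left]
        simp
      have e2 : (ascPochhammer ℝ (n + (m + 1))).eval (α + 1)
          = (ascPochhammer ℝ n).eval (α + 1) * (ascPochhammer ℝ (m + 1)).eval (α + 1 + n) := by
        rw [← ascPochhammer_mul]
        simp
      rw [show 2 + α = α + 1 + 1 by ring, show α + n + 1 = α + 1 + n by ring, ← e2, mul_comm, ← e1]
      rfl
    have h2 : (ascPochhammer ℝ (n + m)).eval (2 + α) * γ * M m * ((m.factorial : ℝ))⁻¹ = 1 := by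
      have h3 := hMk m
      have h4 : (ascPochhammer ℝ n).eval (α + 1) ≠ 0 := (ascPochhammer_pos n _ hα1).ne'
      have h5 : (m.factorial : ℝ) ≠ 0 := by positivity
      have h6 : (ascPochhammer ℝ (m + 1)).eval (α + n + 1) ≠ 0 :=
        (ascPochhammer_pos _ _ (by linarith)).ne'
      have h7 : M m = (α + 1) * m.factorial / (ascPochhammer ℝ (m + 1)).eval (α + n + 1) := by
        rw [eq_div_iff h6, h3]
      rw [h7, hγ]
      field_simp
      linarith
    have h3 : (((ascPochhammer ℝ (n + m)).eval (2 + α) : ℝ) : ℂ) * γ * M m * ((m.factorial : ℂ))⁻¹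
        = 1 := by simpa using congrArg Complex.ofReal h2
    rw [h3, one_smul]

end

/-! ### The slices as complex planes. -/

theorem unitSphere_mul_self {i : ℍ[ℝ]} (hi : i ∈ unitSphere) : i * i = -1 := by
  have h1 : Quaternion.normSq i = 1 := by
    rw [Quaternion.normSq_eq_norm_mul_self, hi.2, mul_one]
  have h2 : star i = -i := by
    have := hi.1
    ext <;> simp [this]
  have h3 := Quaternion.self_mul_star i
  rw [h1, h2] at h3
  simpa [neg_eq_iff_eq_neg] using h3

theorem neg_mem_unitSphere {i : ℍ[ℝ]} (hi : i ∈ unitSphere) : -i ∈ unitSphere :=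
  ⟨by simp [hi.1], by simp [hi.2]⟩

theorem slice_eq_smul (i : ℍ[ℝ]) (z : ℂ) : slice i z = z.re • (1 : ℍ[ℝ]) + z.im • i := by
  rw [slice, Quaternion.coe_mul_eq_smul, ← mul_one (z.re : ℍ[ℝ]), Quaternion.coe_mul_eq_smul]

theorem slice_mul {i : ℍ[ℝ]} (hi : i ∈ unitSphere) (z w : ℂ) :
    slice i (z * w) = slice i z * slice i w := by
  simp only [slice_eq_smul, Complex.mul_re, Complex.mul_im, add_mul, mul_add, smul_mul_assoc,
    mul_smul_comm, one_mul, mul_one, unitSphere_mul_self hi]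
  module

theorem slice_add (i : ℍ[ℝ]) (z w : ℂ) : slice i (z + w) = slice i z + slice i w := by
  simp only [slice, Complex.add_re, Complex.add_im, Quaternion.coe_add, add_mul]
  abel

theorem slice_ofReal (i : ℍ[ℝ]) (x : ℝ) : slice i (x : ℂ) = (x : ℍ[ℝ]) := by simp [slice]

theorem slice_neg_conj (i : ℍ[ℝ]) (z : ℂ) : slice (-i) (conj z) = slice i z := by simp [slice]

theorem slice_neg (i : ℍ[ℝ]) (z : ℂ) : slice (-i) z = slice i (conj z) := by simp [slice]

theorem norm_slice {i : ℍ[ℝ]} (hi : i ∈ unitSphere) (z : ℂ) : ‖slice i z‖ = ‖z‖ := by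
  have h1 : Quaternion.normSq i = 1 := by
    rw [Quaternion.normSq_eq_norm_mul_self, hi.2, mul_one]
  rw [Quaternion.normSq_def', show i.1 = 0 from hi.1] at h1
  have h2 : ‖slice i z‖ * ‖slice i z‖ = ‖z‖ * ‖z‖ := by
    have h3 : ‖z‖ * ‖z‖ = z.re * z.re + z.im * z.im := by
      rw [← sq, Complex.sq_norm, Complex.normSq_apply]
    rw [← Quaternion.normSq_eq_norm_mul_self, Quaternion.normSq_def', h3, slice, Quaternion.coe_mul_eq_smul]
    simp [show i.re = 0 from hi.1]
    linear_combination z.im ^ 2 * h1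
  exact (mul_self_inj (norm_nonneg _) (norm_nonneg _)).1 h2

/-- The plane embedding `slice i` as a real linear isometry. -/
noncomputable def sliceIsometry (i : ℍ[ℝ]) (hi : i ∈ unitSphere) : ℂ →ₗᵢ[ℝ] ℍ[ℝ] where
  toFun := slice i
  map_add' := slice_add i
  map_smul' c z := by
    simp [slice_eq_smul, mul_smul]
  norm_map' := norm_slice hi

theorem measurableEmbedding_slice {i : ℍ[ℝ]} (hi : i ∈ unitSphere) :
    MeasurableEmbedding (slice i) :=
  (sliceIsometry i hi).isometry.isClosedEmbedding.measurableEmbedding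

/-- A continuous left inverse of `slice i`. -/
noncomputable def sliceInv (i q : ℍ[ℝ]) : ℂ := ⟨q.re, -(q * i).re⟩

theorem sliceInv_slice {i : ℍ[ℝ]} (hi : i ∈ unitSphere) (z : ℂ) : sliceInv i (slice i z) = z := by
  have h : slice i z * i = (z.re : ℍ[ℝ]) * i - (z.im : ℍ[ℝ]) := by
    rw [slice, add_mul, mul_assoc, unitSphere_mul_self hi]
    simp [sub_eq_add_neg]
  unfold sliceInv
  rw [h]
  apply Complex.ext
  · simp [slice, Quaternion.coe_mul_eq_smul, show i.re = 0 from hi.1]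
  · simp [Quaternion.coe_mul_eq_smul, show i.re = 0 from hi.1]

/-- The quaternions with the complex structure given by left multiplication by `i ∈ 𝕊²`. -/
def SliceSpace (_ : unitSphere) : Type := ℍ[ℝ]

namespace SliceSpace

variable (i : unitSphere)

noncomputable instance : NormedAddCommGroup (SliceSpace i) := inferInstanceAs (NormedAddCommGroup ℍ[ℝ])

instance : CompleteSpace (SliceSpace i) := inferInstanceAs (CompleteSpace ℍ[ℝ])

noncomputable instance : Module ℂ (SliceSpace i) where
  smul := fun (z : ℂ) (x : ℍ[ℝ]) => (slice i z * x : ℍ[ℝ])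
  one_smul := fun (x : ℍ[ℝ]) => show slice i 1 * x = x by simp [slice]
  mul_smul := fun z w (x : ℍ[ℝ]) => show slice i (z * w) * x = slice i z * (slice i w * x) by
    rw [slice_mul i.2, mul_assoc]
  smul_zero := fun z => mul_zero (slice i z)
  smul_add := fun z (x y : ℍ[ℝ]) => mul_add (slice i z) x y
  add_smul := fun z w (x : ℍ[ℝ]) => show slice i (z + w) * x = slice i z * x + slice i w * x by
    rw [slice_add, add_mul]
  zero_smul := fun (x : ℍ[ℝ]) => show slice i 0 * x = 0 by simp [slice]

noncomputable instance : NormedSpace ℂ (SliceSpace i) where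
  norm_smul_le := fun z (x : ℍ[ℝ]) => show ‖slice i z * x‖ ≤ ‖z‖ * ‖x‖ by
    rw [norm_mul, norm_slice i.2]

end SliceSpace

/-- The identity map from the quaternions to `SliceSpace i`, a real linear isometry. -/
noncomputable def toSlice (i : unitSphere) : ℍ[ℝ] ≃ₗᵢ[ℝ] SliceSpace i where
  toFun x := x
  invFun x := x
  left_inv _ := rfl
  right_inv _ := rfl
  map_add' _ _ := rfl
  map_smul' c x := by
    change c • x = slice i (c : ℂ) * x
    rw [slice_ofReal, Quaternion.coe_mul_eq_smul]
  norm_map' _ := rfl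

theorem toSlice_mul (i : unitSphere) (z : ℂ) (x : ℍ[ℝ]) :
    toSlice i (slice i z * x) = z • toSlice i x := rfl

/-! ### Imaginary units and coordinates -/

theorem e₁_mem_unitSphere : e₁ ∈ unitSphere := by
  refine ⟨rfl, ?_⟩
  have : ‖e₁‖ * ‖e₁‖ = 1 := by
    rw [← Quaternion.normSq_eq_norm_mul_self, Quaternion.normSq_def']
    simp [e₁]
  nlinarith [norm_nonneg e₁]

theorem imUnit_mem_unitSphere (q : ℍ[ℝ]) : imUnit q ∈ unitSphere := by
  unfold imUnit
  split_ifs with h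
  · exact e₁_mem_unitSphere
  · refine ⟨by rw [Quaternion.coe_mul_eq_smul, Quaternion.re_smul, Quaternion.re_im, smul_zero], ?_⟩
    rw [Quaternion.coe_mul_eq_smul, norm_smul, norm_inv, norm_norm,
      inv_mul_cancel₀ (norm_ne_zero_iff.2 h)]

theorem slice_imUnit_coord (q : ℍ[ℝ]) : slice (imUnit q) (coord q) = q := by
  unfold slice coord imUnit
  split_ifs with h
  · simp only [h, norm_zero, Quaternion.coe_zero, zero_mul, add_zero]
    conv_rhs => rw [← Quaternion.re_add_im q, h, add_zero]
  · rw [← mul_assoc, ← Quaternion.coe_mul, mul_inv_cancel₀ (norm_ne_zero_iff.2 h),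
      Quaternion.coe_one, one_mul, Quaternion.re_add_im]

theorem norm_coord (q : ℍ[ℝ]) : ‖coord q‖ = ‖q‖ := by
  rw [← norm_slice (imUnit_mem_unitSphere q), slice_imUnit_coord]

theorem im_slice {i : ℍ[ℝ]} (hi : i ∈ unitSphere) (z : ℂ) : (slice i z).im = z.im • i := by
  have : i.re = 0 := hi.1
  ext <;> simp [slice, Quaternion.coe_mul_eq_smul, this]

theorem re_slice {i : ℍ[ℝ]} (hi : i ∈ unitSphere) (z : ℂ) : (slice i z).re = z.re := by
  have : i.re = 0 := hi.1
  simp [slice, Quaternion.coe_mul_eq_smul, this]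

theorem ne_zero_of_mem_unitSphere {i : ℍ[ℝ]} (hi : i ∈ unitSphere) : i ≠ 0 := by
  rintro rfl
  have := hi.2
  simp at this

theorem norm_im_slice {i : ℍ[ℝ]} (hi : i ∈ unitSphere) (z : ℂ) : ‖(slice i z).im‖ = |z.im| := by
  rw [im_slice hi, norm_smul, hi.2, mul_one, Real.norm_eq_abs]

theorem imUnit_slice_of_pos {i : ℍ[ℝ]} (hi : i ∈ unitSphere) {z : ℂ} (hz : 0 < z.im) :
    imUnit (slice i z) = i := by
  have h : (slice i z).im ≠ 0 := by
    rw [im_slice hi]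
    exact smul_ne_zero hz.ne' (ne_zero_of_mem_unitSphere hi)
  rw [imUnit, if_neg h, norm_im_slice hi, abs_of_pos hz, im_slice hi, Quaternion.coe_mul_eq_smul,
    smul_smul, inv_mul_cancel₀ hz.ne', one_smul]

theorem coord_slice_of_pos {i : ℍ[ℝ]} (hi : i ∈ unitSphere) {z : ℂ} (hz : 0 ≤ z.im) :
    coord (slice i z) = z := by
  rw [coord, norm_im_slice hi, abs_of_nonneg hz, re_slice hi]

theorem imUnit_slice_of_neg {i : ℍ[ℝ]} (hi : i ∈ unitSphere) {z : ℂ} (hz : z.im < 0) :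
    imUnit (slice i z) = -i := by
  rw [← slice_neg_conj, imUnit_slice_of_pos (neg_mem_unitSphere hi) (by simpa using hz)]

theorem coord_slice_of_neg {i : ℍ[ℝ]} (hi : i ∈ unitSphere) {z : ℂ} (hz : z.im < 0) :
    coord (slice i z) = conj z := by
  rw [← slice_neg_conj, coord_slice_of_pos (neg_mem_unitSphere hi) (by simpa using hz.le)]

/-- This is the representation formula for the identity function, a consequence of i² = -1. Applied
to zᵏ/k! it yields the formula for power series. -/
theorem slice_eq_sliceExt {i : ℍ[ℝ]} (hi : i ∈ unitSphere) (I : ℍ[ℝ]) (z : ℂ) :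
    slice I z = (2⁻¹ : ℝ) • ((1 + I * i) * slice i (conj z) + (1 - I * i) * slice i z) := by
  have h : (1 + I * i) * slice i (conj z) + (1 - I * i) * slice i z = (2 : ℝ) • slice I z := by
    have h1 := unitSphere_mul_self hi
    have h2 : I * i * (z.im • i) = -(z.im • I) := by
      rw [mul_smul_comm, mul_assoc, h1]
      simp
    have h3 : I * i * (z.re : ℍ[ℝ]) = z.re • (I * i) := Quaternion.mul_coe_eq_smul _ _
    simp only [slice, Complex.conj_re, Complex.conj_im, Quaternion.coe_mul_eq_smul, neg_smul,
      add_mul, sub_mul, mul_add, one_mul, mul_neg, h2, h3, two_smul]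
    abel
  rw [h, smul_smul]
  norm_num

/-- Evaluating an extension on the original slice recovers the function. -/
theorem sliceExt_slice {i : ℍ[ℝ]} (hi : i ∈ unitSphere) (D : ℂ → ℍ[ℝ]) (z : ℂ) :
    sliceExt i D (slice i z) = D z := by
  have h1 := unitSphere_mul_self hi
  have h2 : ∀ x : ℍ[ℝ], (2⁻¹ : ℝ) • ((1 + 1) * x) = x := fun x => by
    rw [add_mul, one_mul, ← two_smul ℝ, smul_smul]; norm_num
  unfold sliceExt
  rcases lt_trichotomy z.im 0 with h | h | h
  · rw [imUnit_slice_of_neg hi h, coord_slice_of_neg hi h, neg_mul, h1]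
    simp only [neg_neg, sub_self, zero_mul, add_zero, Complex.conj_conj, h2]
  -- At a real point both values of `D` coincide and the terms with the imaginary unit cancel, so
  -- the conventional choice `e₁` is immaterial.
  · rw [coord_slice_of_pos hi h.ge, Complex.conj_eq_iff_im.2 h, ← add_mul]
    convert! h2 (D z) using 3
    abel
  · rw [imUnit_slice_of_pos hi h, coord_slice_of_pos hi h.le, h1]
    simp only [add_neg_cancel, zero_mul, zero_add, sub_neg_eq_add, h2]

/-- The kernel at a nonreal point of the slice `ℂ(i)` as an extension from this slice. -/
theorem kernel_slice {i : ℍ[ℝ]} (hi : i ∈ unitSphere) (α : ℝ) {q : ℍ[ℝ]} (hq : ‖q‖ < 1) {w : ℂ}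
    (hw : ‖w‖ < 1) (hw0 : w.im ≠ 0) :
    kernel α q (slice i w)
      = sliceExt i (fun z => slice i ((1 - z * conj w) ^ (-((2 + α : ℝ) : ℂ)))) q := by
  unfold kernel
  rcases lt_or_gt_of_ne hw0 with h | h
  · rw [imUnit_slice_of_neg hi h, coord_slice_of_neg hi h]
    -- For w in the lower half-disc the kernel is built from the unit -i and the coordinate w̄.
    -- Conjugation commutes with the principal power since 1-zw lies in the slit plane; the two
    -- terms of the extension then change places.
    have key : ∀ z : ℂ, ‖z‖ < 1 →
        slice (-i) ((1 - z * conj (conj w)) ^ (-((2 + α : ℝ) : ℂ)))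
          = slice i ((1 - conj z * conj w) ^ (-((2 + α : ℝ) : ℂ))) := by
      intro z hz
      rw [slice_neg, ← map_mul]
      congr 1
      have h2 : 1 - conj (z * w) = conj (1 - z * w) := by simp
      have h3 : (1 - z * w).arg ≠ π := by
        apply Complex.slitPlane_arg_ne_pi
        have := one_sub_mul_conj_mem_slitPlane (z := z) (w := conj w) hz (by simpa using hw.le)
        simpa using this
      rw [h2, Complex.conj_cpow _ _ h3, ← Complex.ofReal_neg, Complex.conj_ofReal, Complex.conj_conj]
    have hc : ‖coord q‖ < 1 := by rwa [norm_coord]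
    simp only [sliceExt]
    rw [key _ hc, key _ (by simpa using hc)]
    simp only [Complex.conj_conj, mul_neg, sub_neg_eq_add]
    rw [← sub_eq_add_neg, add_comm]
  · rw [imUnit_slice_of_pos hi h, coord_slice_of_pos hi h.le]

/-! ### The measures on a slice -/

theorem areaMeasure_eq_map (i : ℍ[ℝ]) : areaMeasure i = discArea.map (slice i) := by
  rw [areaMeasure, discArea, Measure.map_smul]

theorem map_withDensity_comp {X Y : Type*} [MeasurableSpace X] [MeasurableSpace Y] {φ : X → Y}
    (hφ : MeasurableEmbedding φ) (μ : Measure X) (d : Y → ℝ≥0∞) :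
    (μ.map φ).withDensity d = (μ.withDensity (d ∘ φ)).map φ := by
  ext s hs
  rw [withDensity_apply _ hs, Measure.map_apply hφ.measurable hs,
    withDensity_apply _ (hφ.measurable hs), hφ.restrict_map, hφ.lintegral_map]
  rfl

theorem lambdaMeasure_eq_map {i : ℍ[ℝ]} (hi : i ∈ unitSphere) :
    lambdaMeasure i = discHyp.map (slice i) := by
  rw [lambdaMeasure, areaMeasure_eq_map, map_withDensity_comp (measurableEmbedding_slice hi)]
  simp only [Function.comp_def, norm_slice hi]
  rfl

theorem weightedMeasure_eq_map {i : ℍ[ℝ]} (hi : i ∈ unitSphere) (α : ℝ) :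
    weightedMeasure α i = (discWeighted α).map (slice i) := by
  rw [weightedMeasure, areaMeasure_eq_map, map_withDensity_comp (measurableEmbedding_slice hi)]
  simp only [Function.comp_def, norm_slice hi]
  rfl

/-- The real diameter, where `imUnit` takes the value `e₁` whatever i is, can thus be ignored in
integrals over the slice. -/
theorem ae_discArea_im_ne_zero : ∀ᵐ w ∂discArea, w.im ≠ 0 := by
  refine Measure.ae_smul_measure ?_ _
  refine ae_restrict_of_ae ?_
  have h : volume (Complex.measurableEquivRealProd ⁻¹' (univ ×ˢ ({0} : Set ℝ))) = 0 := by
    rw [Complex.volume_preserving_equiv_real_prod.measure_preimage_equiv, Measure.volume_eq_prod,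
      Measure.prod_prod]
    simp
  rw [ae_iff]
  refine measure_mono_null ?_ h
  intro w hw
  simpa using hw

theorem ae_discWeighted_im_ne_zero (α : ℝ) : ∀ᵐ w ∂discWeighted α, w.im ≠ 0 :=
  (withDensity_absolutelyContinuous _ _).ae_le ae_discArea_im_ne_zero

/-- Needed because the representation formula involves z̄ as well as z. -/
theorem measurePreserving_conj_discHyp : MeasurePreserving (conj : ℂ → ℂ) discHyp discHyp := by
  have h1 : MeasurePreserving (conj : ℂ → ℂ) (volume : Measure ℂ) volume :=
    Complex.conjLIE.measurePreserving
  have h2 := h1.restrict_preimage (s := Metric.ball (0 : ℂ) 1) Metric.isOpen_ball.measurableSet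
  have h3 : (conj : ℂ → ℂ) ⁻¹' Metric.ball 0 1 = Metric.ball 0 1 := by
    ext w
    simp
  rw [h3] at h2
  have h4 : MeasurePreserving (conj : ℂ → ℂ) discArea discArea := h2.smul_measure _
  refine ⟨h4.measurable, ?_⟩
  have h5 := map_withDensity_comp (φ := (conj : ℂ → ℂ)) Complex.conjLIE.toHomeomorph.measurableEmbedding discArea
    (fun z => ENNReal.ofReal (((1 - ‖z‖ ^ 2) ^ 2)⁻¹))
  rw [h4.map_eq] at h5
  simp only [Function.comp_def, Complex.norm_conj] at h5
  exact h5.symm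

/-! ### The restriction of a slice regular function to a slice -/

/-- The restriction of `f` to the disc of `ℂ(i)` with values in `SliceSpace i`. -/
noncomputable def restr (i : unitSphere) (f : ℍ[ℝ] → ℍ[ℝ]) (z : ℂ) : SliceSpace i :=
  toSlice i (f (slice i z))

theorem slice_mem_unitBall {i : ℍ[ℝ]} (hi : i ∈ unitSphere) {z : ℂ} (hz : ‖z‖ < 1) :
    slice i z ∈ unitBall := by
  rw [unitBall, mem_ball_zero_iff, norm_slice hi]
  exact hz

/-- With A the real differential of f, the slice equation reads A(1) + iA(i) = 0, that is A(i) =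
iA(1): the Cauchy–Riemann equation for left multiplication by i. -/
theorem differentiableOn_restr {f : ℍ[ℝ] → ℍ[ℝ]} (hf : IsSliceRegularOn f unitBall)
    (i : unitSphere) : DifferentiableOn ℂ (restr i f) (Metric.ball 0 1) := by
  intro z hz
  have hq := slice_mem_unitBall i.2 (mem_ball_zero_iff.1 hz)
  have hfd : DifferentiableAt ℝ f (slice i z) :=
    (hf.1 _ hq).differentiableAt (Metric.isOpen_ball.mem_nhds hq)
  set A := fderiv ℝ f (slice i z) with hA
  set S : ℂ →L[ℝ] ℍ[ℝ] := (sliceIsometry i i.2).toContinuousLinearMap with hS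
  have hSd : HasFDerivAt (slice i) S z := S.hasFDerivAt
  have hF : HasFDerivAt (restr i f)
      (((toSlice i).toContinuousLinearEquiv : ℍ[ℝ] →L[ℝ] SliceSpace i).comp (A.comp S)) z :=
    ((toSlice i).toContinuousLinearEquiv.hasFDerivAt).comp z (hfd.hasFDerivAt.comp z hSd)
  refine DifferentiableAt.differentiableWithinAt ?_
  rw [differentiableAt_complex_iff_differentiableAt_real]
  refine ⟨hF.differentiableAt, ?_⟩
  rw [hF.fderiv]
  have hcoe : ∀ x : ℝ, HasDerivAt (fun s : ℝ => (s : ℍ[ℝ])) 1 x := fun x => by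
    have := (hasDerivAt_id x).smul_const (1 : ℍ[ℝ])
    simpa [← Quaternion.coe_mul_eq_smul] using this
  have d1 : HasDerivAt (fun s : ℝ => f ((s : ℍ[ℝ]) + (z.im : ℍ[ℝ]) * i)) (A 1) z.re := by
    have h := (hcoe z.re).add_const ((z.im : ℍ[ℝ]) * i)
    exact hfd.hasFDerivAt.comp_hasDerivAt z.re h
  have d2 : HasDerivAt (fun t : ℝ => f ((z.re : ℍ[ℝ]) + (t : ℍ[ℝ]) * i)) (A i) z.im := by
    have h := ((hcoe z.im).mul_const (i : ℍ[ℝ])).const_add (z.re : ℍ[ℝ])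
    rw [one_mul] at h
    exact hfd.hasFDerivAt.comp_hasDerivAt z.im h
  have hCR := hf.2 i i.2 z.re z.im hq
  rw [d1.deriv, d2.deriv] at hCR
  have h1 : S Complex.I = i := by
    change slice i Complex.I = i
    simp [slice]
  have h2 : S 1 = 1 := by
    change slice i 1 = 1
    simp [slice]
  change toSlice i (A (S Complex.I)) = Complex.I • toSlice i (A (S 1))
  rw [h1, h2, ← toSlice_mul]
  have h3 : slice i Complex.I = i := h1
  rw [h3]
  congr 1
  have h4 : A 1 = -(i * A i) := eq_neg_of_add_eq_zero_left hCR
  rw [h4, mul_neg, ← mul_assoc, unitSphere_mul_self i.2, neg_one_mul, neg_neg]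

theorem iteratedDeriv_real_line {E : Type*} [NormedAddCommGroup E] [NormedSpace ℂ E]
    [CompleteSpace E] {u : ℂ → E} (hu : DifferentiableOn ℂ u (Metric.ball 0 1)) (n : ℕ) {z : ℂ}
    {t : ℝ} (hz : ‖z + t‖ < 1) :
    iteratedDeriv n (fun s : ℝ => u (z + s)) t = iteratedDeriv n u (z + t) := by
  induction n generalizing t with
  | zero => simp
  | succ n ih =>
    rw [iteratedDeriv_succ]
    have hopen : IsOpen {s : ℝ | ‖z + s‖ < 1} := isOpen_lt (by fun_prop) continuous_const
    have h1 : iteratedDeriv n (fun s : ℝ => u (z + s)) =ᶠ[nhds t]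
        fun s => iteratedDeriv n u (z + s) := by
      filter_upwards [hopen.mem_nhds hz] with s hs using ih hs
    rw [h1.deriv_eq]
    have hd := (differentiableOn_iteratedDeriv Metric.isOpen_ball hu n).differentiableAt
      (Metric.isOpen_ball.mem_nhds (mem_ball_zero_iff.2 hz))
    have h2 : HasDerivAt (fun s : ℝ => z + (s : ℂ)) 1 t := by
      simpa using (Complex.ofRealCLM.hasDerivAt (x := t)).const_add z
    have h3 := hd.hasDerivAt.scomp t h2
    rw [iteratedDeriv_succ]
    rw [one_smul] at h3
    exact h3.deriv

theorem toSlice_realDeriv {f : ℍ[ℝ] → ℍ[ℝ]} (hf : IsSliceRegularOn f unitBall) (i : unitSphere)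
    (n : ℕ) {z : ℂ} (hz : ‖z‖ < 1) :
    toSlice i (realDeriv n f (slice i z)) = iteratedDeriv n (restr i f) z := by
  have h1 := iteratedDeriv_real_line (differentiableOn_restr hf i) n (z := z) (t := 0) (by simpa using hz)
  rw [Complex.ofReal_zero, add_zero] at h1
  rw [← h1, realDeriv, iteratedDeriv_eq_iteratedFDeriv, iteratedDeriv_eq_iteratedFDeriv]
  have h2 : (fun s : ℝ => restr i f (z + s))
      = (toSlice i).toContinuousLinearEquiv ∘ fun t : ℝ => f (slice i z + (t : ℍ[ℝ])) := by
    funext s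
    simp only [restr, slice_add, slice_ofReal, Function.comp_apply]
    rfl
  rw [h2, ContinuousLinearEquiv.iteratedFDeriv_comp_left]
  rfl

/-- Slice regularity assumes only one real derivative; the smoothness comes from analyticity of the
restriction to the slice. -/
theorem contDiffAt_line {f : ℍ[ℝ] → ℍ[ℝ]} (hf : IsSliceRegularOn f unitBall) {i : ℍ[ℝ]}
    (hi : i ∈ unitSphere) (n : ℕ) {z : ℂ} (hz : ‖z‖ < 1) :
    ContDiffAt ℝ n (fun t : ℝ => f (slice i z + (t : ℍ[ℝ]))) 0 := by
  have h1 : AnalyticAt ℂ (restr ⟨i, hi⟩ f) z :=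
    (differentiableOn_restr hf ⟨i, hi⟩).analyticAt (Metric.isOpen_ball.mem_nhds (mem_ball_zero_iff.2 hz))
  have h2 : ContDiffAt ℝ n (restr ⟨i, hi⟩ f) (z + ((0 : ℝ) : ℂ)) := by
    simpa using h1.contDiffAt.restrict_scalars ℝ
  have h3 : ContDiffAt ℝ n (fun t : ℝ => z + (t : ℂ)) 0 :=
    (contDiff_const.add Complex.ofRealCLM.contDiff).contDiffAt
  have h4 := (toSlice ⟨i, hi⟩).symm.toContinuousLinearEquiv.contDiff.contDiffAt.comp (0 : ℝ)
    (h2.comp (0 : ℝ) h3)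
  convert! h4 using 1
  funext t
  change _ = f (slice i (z + t))
  rw [slice_add, slice_ofReal]

/-- The origin and the real direction belong to every slice, so the coefficients `realDeriv k f 0`
do not depend on i. -/
theorem hasSum_slice {f : ℍ[ℝ] → ℍ[ℝ]} (hf : IsSliceRegularOn f unitBall) {i : ℍ[ℝ]}
    (hi : i ∈ unitSphere) {z : ℂ} (hz : ‖z‖ < 1) :
    HasSum (fun k : ℕ => slice i (z ^ k * (k.factorial : ℂ)⁻¹) * realDeriv k f 0)
      (f (slice i z)) := by
  have h1 := hasSum_taylor (differentiableOn_restr hf ⟨i, hi⟩) z (mem_ball_zero_iff.2 hz)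
  have h2 := ((toSlice ⟨i, hi⟩).symm.toContinuousLinearEquiv : SliceSpace ⟨i, hi⟩ →L[ℝ] ℍ[ℝ]).hasSum h1
  convert! h2 using 1
  funext k
  have h3 := toSlice_realDeriv hf ⟨i, hi⟩ k (z := 0) (by simp)
  have h4 : slice i 0 = 0 := by simp [slice]
  rw [← h3, smul_smul, h4]
  rfl

/-- The representation formula for slice regular functions. -/
theorem representation_formula {f : ℍ[ℝ] → ℍ[ℝ]} (hf : IsSliceRegularOn f unitBall) {i I : ℍ[ℝ]}
    (hi : i ∈ unitSphere) (hI : I ∈ unitSphere) {z : ℂ} (hz : ‖z‖ < 1) :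
    f (slice I z) = (2⁻¹ : ℝ) • ((1 + I * i) * f (slice i (conj z)) + (1 - I * i) * f (slice i z)) := by
  have h1 := hasSum_slice hf hI hz
  have h2 := hasSum_slice hf hi hz
  have h3 := hasSum_slice hf hi (z := conj z) (by simpa using hz)
  refine h1.unique ?_
  convert! ((h3.mul_left (1 + I * i)).add (h2.mul_left (1 - I * i))).const_smul (2⁻¹ : ℝ) using 1
  funext k
  -- The two series agree term by term, since zᵏ/k! has real coefficients and so commutes with
  -- conjugation.
  rw [slice_eq_sliceExt hi I]
  simp only [map_mul, map_pow, map_inv₀, map_natCast, smul_mul_assoc, add_mul, mul_assoc]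

theorem eq_sliceExt {f : ℍ[ℝ] → ℍ[ℝ]} (hf : IsSliceRegularOn f unitBall) {i : ℍ[ℝ]}
    (hi : i ∈ unitSphere) {q : ℍ[ℝ]} (hq : q ∈ unitBall) :
    f q = sliceExt i (fun z => f (slice i z)) q := by
  have hc : ‖coord q‖ < 1 := by rw [norm_coord]; exact mem_ball_zero_iff.1 hq
  have := representation_formula hf hi (imUnit_mem_unitSphere q) hc
  rwa [slice_imUnit_coord] at this

/-- A real translation is compatible with conjugation and with every slice embedding, so the
representation formula may be differentiated along it. -/
theorem realDeriv_slice {f : ℍ[ℝ] → ℍ[ℝ]} (hf : IsSliceRegularOn f unitBall) {i I : ℍ[ℝ]}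
    (hi : i ∈ unitSphere) (hI : I ∈ unitSphere) (n : ℕ) {z : ℂ} (hz : ‖z‖ < 1) :
    realDeriv n f (slice I z) = (2⁻¹ : ℝ) • ((1 + I * i) * realDeriv n f (slice i (conj z))
      + (1 - I * i) * realDeriv n f (slice i z)) := by
  have hopen : IsOpen {s : ℝ | ‖z + s‖ < 1} := isOpen_lt (by fun_prop) continuous_const
  have h1 : (fun t : ℝ => f (slice I z + (t : ℍ[ℝ]))) =ᶠ[nhds 0] fun t : ℝ =>
      (2⁻¹ : ℝ) • ((1 + I * i) * f (slice i (conj z) + (t : ℍ[ℝ]))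
        + (1 - I * i) * f (slice i z + (t : ℍ[ℝ]))) := by
    filter_upwards [hopen.mem_nhds (show ‖z + ((0 : ℝ) : ℂ)‖ < 1 by simpa using hz)] with t ht
    have := representation_formula hf hi hI ht
    rwa [map_add, Complex.conj_ofReal, slice_add, slice_add, slice_add, slice_ofReal,
      slice_ofReal] at this
  have c1 := contDiffAt_line hf hi n (z := conj z) (by simpa using hz)
  have c2 := contDiffAt_line hf hi n hz
  unfold realDeriv
  rw [h1.iteratedDeriv_eq, iteratedDeriv_fun_const_smul_field, iteratedDeriv_fun_add (contDiffAt_const.mul c1)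
    (contDiffAt_const.mul c2), iteratedDeriv_const_mul _ c1, iteratedDeriv_const_mul _ c2]

/-! ### Transfer from the disc to the quaternionic ball. -/

theorem enorm_toSlice (i : unitSphere) (x : ℍ[ℝ]) : ‖toSlice i x‖ₑ = ‖x‖ₑ := rfl

theorem memLp_toSlice_comp_iff (i : unitSphere) {h : ℍ[ℝ] → ℍ[ℝ]} {p : ℝ≥0∞} :
    MemLp (restr i h) p discHyp ↔ MemLp h p (lambdaMeasure i) := by
  rw [lambdaMeasure_eq_map i.2, (measurableEmbedding_slice i.2).memLp_map_measure_iff]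
  constructor
  · intro H
    exact ((toSlice i).symm.toContinuousLinearEquiv : SliceSpace i →L[ℝ] ℍ[ℝ]).comp_memLp' H
  · intro H
    exact ((toSlice i).toContinuousLinearEquiv : ℍ[ℝ] →L[ℝ] SliceSpace i).comp_memLp' H

theorem integrable_slice_kernel_mul (i : unitSphere) {α : ℝ} (hα : -1 < α) {h : ℍ[ℝ] → ℍ[ℝ]}
    (hh : Integrable (restr i h) (discWeighted α)) {z : ℂ} (hz : ‖z‖ < 1) :
    Integrable (fun w => slice i ((1 - z * conj w) ^ (-((2 + α : ℝ) : ℂ))) * h (slice i w))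
      (discWeighted α) := by
  have h1 := integrable_kernel_smul (ae_discWeighted_mem_ball α) hh (by linarith : 0 ≤ 2 + α) hz
  exact ((toSlice i).symm.toContinuousLinearEquiv : SliceSpace i →L[ℝ] ℍ[ℝ]).integrable_comp h1

theorem integral_slice_kernel_mul (i : unitSphere) (α : ℝ) (h : ℍ[ℝ] → ℍ[ℝ]) (z : ℂ) :
    ∫ w, slice i ((1 - z * conj w) ^ (-((2 + α : ℝ) : ℂ))) * h (slice i w) ∂discWeighted α
      = (toSlice i).symm (discProj α (restr i h) z) :=
  (toSlice i).symm.toContinuousLinearEquiv.integral_comp_comm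
    (fun w => (1 - z * conj w) ^ (-((2 + α : ℝ) : ℂ)) • restr i h w)

/-- The quaternionic Bergman operator is the extension of the complex one. -/
theorem bergmanProj_eq_sliceExt (i : unitSphere) {α : ℝ} (hα : -1 < α) {h : ℍ[ℝ] → ℍ[ℝ]}
    (hh : Integrable (restr i h) (discWeighted α)) {q : ℍ[ℝ]} (hq : q ∈ unitBall) :
    bergmanProj α i h q
      = sliceExt i (fun z => (toSlice i).symm (discProj α (restr i h) z)) q := by
  have hq' : ‖q‖ < 1 := mem_ball_zero_iff.1 hq
  have hc : ‖coord q‖ < 1 := by rwa [norm_coord]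
  have i1 := integrable_slice_kernel_mul i hα hh (z := conj (coord q)) (by simpa using hc)
  have i2 := integrable_slice_kernel_mul i hα hh hc
  rw [bergmanProj, weightedMeasure_eq_map i.2, (measurableEmbedding_slice i.2).integral_map]
  have hae : ∀ᵐ w ∂discWeighted α, kernel α q (slice i w) * h (slice i w) = (2⁻¹ : ℝ) •
      ((1 + imUnit q * i) * (slice i ((1 - conj (coord q) * conj w) ^ (-((2 + α : ℝ) : ℂ)))
          * h (slice i w))
        + (1 - imUnit q * i) * (slice i ((1 - coord q * conj w) ^ (-((2 + α : ℝ) : ℂ)))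
          * h (slice i w))) := by
    filter_upwards [ae_discWeighted_mem_ball α, ae_discWeighted_im_ne_zero α] with w hw hw0
    rw [kernel_slice i.2 α hq' hw hw0, sliceExt, smul_mul_assoc, add_mul, mul_assoc, mul_assoc]
  rw [integral_congr_ae hae, integral_smul, integral_add (i1.const_mul _) (i2.const_mul _),
    integral_const_mul_of_integrable i1, integral_const_mul_of_integrable i2,
    integral_slice_kernel_mul, integral_slice_kernel_mul]
  rfl

theorem lintegral_lambdaMeasure_realDeriv (f : ℍ[ℝ] → ℍ[ℝ]) {I : ℍ[ℝ]} (hI : I ∈ unitSphere)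
    (n : ℕ) (p : ℝ) :
    ∫⁻ q, ‖(1 - ‖q‖ ^ 2) ^ n • realDeriv n f q‖ₑ ^ p ∂lambdaMeasure I
      = ∫⁻ z, (discWeight n z * ‖realDeriv n f (slice I z)‖ₑ) ^ p ∂discHyp := by
  rw [lambdaMeasure_eq_map hI, (measurableEmbedding_slice hI).lintegral_map]
  refine lintegral_congr_ae ?_
  filter_upwards [ae_discHyp_mem_ball] with z hz
  have := one_sub_norm_sq_pos hz
  rw [norm_slice hI, enorm_smul, discWeight, Real.rpow_natCast, ← ofReal_norm ((1 - ‖z‖ ^ 2) ^ n),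
    Real.norm_of_nonneg (by positivity)]

/-- As |1 ± Ii| ≤ 2, the derivative on the slice of I is at most the sum of the norms at z and z̄ on
the slice of i. Convexity of the p-th power and invariance of dλ under conjugation give the factor
2^p. -/
theorem lintegral_realDeriv_slice_le {f : ℍ[ℝ] → ℍ[ℝ]} (hf : IsSliceRegularOn f unitBall)
    (i : unitSphere) {I : ℍ[ℝ]} (hI : I ∈ unitSphere) (n : ℕ) {p : ℝ} (hp : 1 ≤ p) :
    ∫⁻ z, (discWeight n z * ‖realDeriv n f (slice I z)‖ₑ) ^ p ∂discHyp
      ≤ 2 ^ p * ∫⁻ z, (discWeight n z * ‖iteratedDeriv n (restr i f) z‖ₑ) ^ p ∂discHyp := by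
  have hp0 : 0 ≤ p := by linarith
  set g : ℂ → ℝ≥0∞ := fun z => (discWeight n z * ‖iteratedDeriv n (restr i f) z‖ₑ) ^ p with hg
  have hgm : AEMeasurable g discHyp := by
    refine ((measurable_discWeight n).aemeasurable.mul (AEStronglyMeasurable.enorm ?_)).pow_const p
    exact aestronglyMeasurable_discHyp (differentiableOn_iteratedDeriv Metric.isOpen_ball
      (differentiableOn_restr hf i) n).continuousOn
  have hunit : ‖I * (i : ℍ[ℝ])‖ = 1 := by rw [norm_mul, hI.2, i.2.2, mul_one]
  have key : ∀ z : ℂ, ‖z‖ < 1 → ‖realDeriv n f (slice I z)‖ₑ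
      ≤ ‖iteratedDeriv n (restr i f) (conj z)‖ₑ + ‖iteratedDeriv n (restr i f) z‖ₑ := by
    intro z hz
    rw [← toSlice_realDeriv hf i n hz, ← toSlice_realDeriv hf i n (z := conj z) (by simpa using hz),
      enorm_toSlice, enorm_toSlice, realDeriv_slice hf i.2 hI n hz]
    set a := realDeriv n f (slice i (conj z))
    set b := realDeriv n f (slice i z)
    rw [← ofReal_norm, ← ofReal_norm, ← ofReal_norm, ← ENNReal.ofReal_add (norm_nonneg _) (norm_nonneg _)]
    apply ENNReal.ofReal_le_ofReal
    have e1 : ‖1 + I * (i : ℍ[ℝ])‖ ≤ 2 := (norm_add_le _ _).trans (by rw [hunit, norm_one]; norm_num)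
    have e2 : ‖1 - I * (i : ℍ[ℝ])‖ ≤ 2 := (norm_sub_le _ _).trans (by rw [hunit, norm_one]; norm_num)
    rw [norm_smul]
    calc _ ≤ ‖(2⁻¹ : ℝ)‖ * (2 * ‖a‖ + 2 * ‖b‖) := by
          gcongr
          refine (norm_add_le _ _).trans ?_
          rw [norm_mul, norm_mul]
          gcongr
      _ = _ := by norm_num; ring
  calc _ ≤ ∫⁻ z, 2 ^ (p - 1) * (g (conj z) + g z) ∂discHyp := by
        refine lintegral_mono_ae ?_
        filter_upwards [ae_discHyp_mem_ball] with z hz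
        calc _ ≤ (discWeight n z * ‖iteratedDeriv n (restr i f) (conj z)‖ₑ
              + discWeight n z * ‖iteratedDeriv n (restr i f) z‖ₑ) ^ p := by
              rw [← mul_add]
              exact ENNReal.rpow_le_rpow (mul_le_mul_right (key z hz) _) hp0
          _ ≤ _ := ENNReal.rpow_add_le_mul_rpow_add_rpow _ _ hp
          _ = _ := by simp only [hg, discWeight, Complex.norm_conj]
    _ = 2 ^ (p - 1) * (∫⁻ z, g z ∂discHyp + ∫⁻ z, g z ∂discHyp) := by
        rw [lintegral_const_mul' _ _ (ENNReal.rpow_ne_top_of_nonneg (by linarith) (by simp)),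
          lintegral_add_right' _ hgm, measurePreserving_conj_discHyp.lintegral_comp_emb
            Complex.conjLIE.toHomeomorph.measurableEmbedding]
    _ = _ := by
        rw [← two_mul, ← mul_assoc]
        congr 1
        have h2 : (2 : ℝ≥0∞) ^ p = 2 ^ (p - 1 + 1) := by ring_nf
        rw [h2, ENNReal.rpow_add _ _ (by simp) (by simp), ENNReal.rpow_one]

/-- Membership in the Besov space can be tested on a single slice. -/
theorem mem_besovSpace_iff {f : ℍ[ℝ] → ℍ[ℝ]} (hf : IsSliceRegularOn f unitBall) (i : unitSphere)
    {n : ℕ} {p : ℝ} (hp : 1 ≤ p) :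
    f ∈ besovSpace p n ↔
      ∫⁻ z, (discWeight n z * ‖iteratedDeriv n (restr i f) z‖ₑ) ^ p ∂discHyp < ∞ := by
  have hi : ∫⁻ z, (discWeight n z * ‖iteratedDeriv n (restr i f) z‖ₑ) ^ p ∂discHyp
      = ∫⁻ q, ‖(1 - ‖q‖ ^ 2) ^ n • realDeriv n f q‖ₑ ^ p ∂lambdaMeasure i := by
    rw [lintegral_lambdaMeasure_realDeriv f i.2]
    refine lintegral_congr_ae ?_
    filter_upwards [ae_discHyp_mem_ball] with z hz
    rw [← toSlice_realDeriv hf i n hz, enorm_toSlice]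
  constructor
  · rintro ⟨-, h⟩
    rw [hi]
    exact (le_iSup₂_of_le (f := fun (I : ℍ[ℝ]) (_ : I ∈ unitSphere) =>
      ∫⁻ q, ‖(1 - ‖q‖ ^ 2) ^ n • realDeriv n f q‖ₑ ^ p ∂lambdaMeasure I) i i.2 le_rfl).trans_lt h
  · intro h
    refine ⟨hf, lt_of_le_of_lt (iSup₂_le fun I hI => ?_)
      (ENNReal.mul_lt_top (ENNReal.rpow_lt_top_of_nonneg (by linarith) ENNReal.ofNat_ne_top : (2 : ℝ≥0∞) ^ p < ∞) h)⟩
    rw [lintegral_lambdaMeasure_realDeriv f hI]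
    exact lintegral_realDeriv_slice_le hf i hI n hp

/-- The Besov space `B_p` is the image of `L^p(dλ_i)` under the Bergman operator. -/
theorem mem_besovSpace_iff_exists_bergmanProj {p α : ℝ} (hp : 1 ≤ p) (hα : -1 < α) {n : ℕ}
    (hn : 1 < (n : ℝ) * p) {f : ℍ[ℝ] → ℍ[ℝ]} (hf : IsSliceRegularOn f unitBall) (i : unitSphere) :
    f ∈ besovSpace p n ↔ ∃ h : ℍ[ℝ] → ℍ[ℝ],
      MemLp h (ENNReal.ofReal p) (lambdaMeasure i) ∧ ∀ q ∈ unitBall, f q = bergmanProj α i h q := by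
  rw [mem_besovSpace_iff hf i hp]
  constructor
  · intro hfin
    obtain ⟨h, hh, hfh⟩ := exists_eqOn_discProj hα hp hn (differentiableOn_restr hf i) hfin
    -- A density on the disc becomes a function on ℍ by composition with `sliceInv`; its values off
    -- the slice are irrelevant.
    have hr : restr i (fun q => (toSlice i).symm (h (sliceInv i q))) = h := by
      funext z
      simp [restr, sliceInv_slice i.2]
    refine ⟨fun q => (toSlice i).symm (h (sliceInv i q)),
      (memLp_toSlice_comp_iff i).1 (by rwa [hr]), fun q hq => ?_⟩
    rw [bergmanProj_eq_sliceExt i hα (by rw [hr]; exact integrable_discWeighted_of_memLp hα hp hh)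
      hq, hr, eq_sliceExt hf i.2 hq]
    have hc : ‖coord q‖ < 1 := by rw [norm_coord]; exact mem_ball_zero_iff.1 hq
    have key : ∀ z : ℂ, ‖z‖ < 1 → f (slice i z) = (toSlice i).symm (discProj α h z) := by
      intro z hz
      rw [← hfh (mem_ball_zero_iff.2 hz), restr, LinearIsometryEquiv.symm_apply_apply]
    rw [sliceExt, sliceExt, key _ hc, key _ (by simpa using hc)]
  · rintro ⟨h, hh, hfh⟩
    have hm := (memLp_toSlice_comp_iff i).2 hh
    have hint := integrable_discWeighted_of_memLp hα hp hm
    refine lt_of_eq_of_lt (lintegral_congr_ae ?_)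
      (lintegral_iteratedDeriv_discProj_lt_top hα hp hn hm)
    -- On the slice of i itself the extension returns the original function, so the quaternionic
    -- identity becomes one between holomorphic functions on the disc.
    have heq : EqOn (restr i f) (discProj α (restr i h)) (Metric.ball 0 1) := by
      intro z hz
      have hq := slice_mem_unitBall i.2 (mem_ball_zero_iff.1 hz)
      rw [restr, hfh _ hq, bergmanProj_eq_sliceExt i hα hint hq, sliceExt_slice i.2,
        LinearIsometryEquiv.apply_symm_apply]
    filter_upwards [ae_discHyp_mem_ball] with z hz
    rw [(heq.eventuallyEq_of_mem (Metric.isOpen_ball.mem_nhds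
      (mem_ball_zero_iff.2 hz))).iteratedDeriv_eq]

end SliceBesov

theorem mainTheorem10 (p α : ℝ) (hp : 1 ≤ p) (hα : -1 < α) (n : ℕ) (hn : 1 < (n : ℝ) * p)
    (f : ℍ[ℝ] → ℍ[ℝ]) (hf : SliceBesov.IsSliceRegularOn f SliceBesov.unitBall)
    (i : ℍ[ℝ]) (hi : i ∈ SliceBesov.unitSphere) :
    f ∈ SliceBesov.besovSpace p n ↔
      ∃ h : ℍ[ℝ] → ℍ[ℝ],
        MeasureTheory.MemLp h (ENNReal.ofReal p) (SliceBesov.lambdaMeasure i) ∧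
        ∀ q ∈ SliceBesov.unitBall, f q = SliceBesov.bergmanProj α i h q :=
  SliceBesov.mem_besovSpace_iff_exists_bergmanProj hp hα hn hf ⟨i, hi⟩
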